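/- Let $d\ge 0$ and $q\ge 1$ be integers and let $G_q\subset\mathbb{C}$ be the group of $q$-th roots of unity. For $S\subseteq\mathbb{Z}^d$ let $\Omega_S=\prod_{x\in S}G_q$ with the product topology, let $G_S=\bigoplus_{x\in S}G_q$ with the discrete topology, acting on $\Omega_S$ by sitewise multiplication, and let $\mathcal{G}_S=\Omega_S\rtimes G_S$ be the transformation groupoid, whose arrow $(\sigma,g)$ has source $\sigma$ and range $g\sigma$; write $\mathcal{G}=\mathcal{G}_{\mathbb{Z}^d}$. The space $C_c(\mathcal{G}_S)$ is a $*$-algebra with $$f_1\cdot f_2(\sigma,g)=\sum_{k\in G_S} f_1(k\sigma,gk^{-1})f_2(\sigma,k),\qquad f^*(\sigma,g)=\overline{f(g\sigma,g^{-1})},$$ and $C^*(\mathcal{G}_S)$ is its completion in the norm $\|\pi(f)\|$, where $\pi$ is the left regular representation on $\ell^2(\mathcal{G}_S)$, $\pi(f)\xi(\sigma,g)=\sum_{h\in G_S} f(h\sigma,gh^{-1})\xi(\sigma,h)$. For finite $\Lambda\subset\mathbb{Z}^d$ one has $C^*(\mathcal{G}_\Lambda)=C_c(\mathcal{G}_\Lambda)$,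 and this algebra is regarded as a subalgebra of $C^*(\mathcal{G})$ by extending $f\in C_c(\mathcal{G}_\Lambda)$ to the function on $\mathcal{G}$ with value $f(\sigma_\Lambda,g_\Lambda)$ at $(\sigma,g)$ if $g_x=1$ for all $x\notin\Lambda$, and $0$ otherwise. An interaction is a family $\phi=(\phi_X)$, indexed by the finite subsets $X$ of $\mathbb{Z}^d$, with $\phi_X=\phi_X^*\in C^*(\mathcal{G}_X)$. For $\lambda>0$ put $$\|\phi\|_\lambda=\sum_{n\ge 0}e^{\lambda n}\sup_{x\in\mathbb{Z}^d}\sum_{X\ni x,\ |X|=n+1}\|\phi_X\|\in[0,\infty].$$ For finite $\Lambda$ let $H_\Lambda(\phi)=\sum_{X\subseteq\Lambda}\phi_X$ and $\tau_t^\Lambda(f)=e^{itH_\Lambda(\phi)}fe^{-itH_\Lambda(\phi)}$ for $f\in C^*(\mathcal{G})$, $t\in\mathbb{R}$. **Theorem (Existence of the dynamics).** Let $\phi$ be an interaction with $\|\phi\|_\lambda<\infty$ for some $\lambda>0$. Then the formula $$\mathcal{D}^\phi(f)=i\sum_{X\cap\Lambda\ne\emptyset}[\phi_X,f],\qquad f\in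 C^*(\mathcal{G}_\Lambda),\ \Lambda\subset\mathbb{Z}^d\text{ finite},$$ in which the series converges absolutely, defines a $*$-derivation $\mathcal{D}^\phi$ of $C^*(\mathcal{G})$ with domain $\bigcup_{\Lambda}C^*(\mathcal{G}_\Lambda)$ (the union over all finite $\Lambda$). This domain is dense, $\mathcal{D}^\phi$ is closable, and its closure is the infinitesimal generator of a strongly continuous one-parameter group $(\tau_t)_{t\in\mathbb{R}}$ of $*$-automorphisms of $C^*(\mathcal{G})$. Moreover, for every $f\in C^*(\mathcal{G})$, $$\lim_{\Lambda\nearrow\mathbb{Z}^d}\|\tau_t(f)-\tau_t^\Lambda(f)\|=0$$ uniformly for $t$ in compact subsets of $\mathbb{R}$, where the limit is along the finite subsets of $\mathbb{Z}^d$ directed by inclusion. -/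

import Mathlib

open scoped CompactlySupported

noncomputable section

/-! ### Configurations, the group of finitely supported spin changes, arrows

Everything is defined over an arbitrary set `S` of sites; `S` will be the lattice `ℤ ^ d` or one of
its finite subsets. The one-site spin space is the group of `q`-th roots of unity. -/

/-- The configuration space: all functions from the sites to the `q`-th roots of unity, with the
product topology. -/
abbrev Config (S : Type) (q : ℕ) : Type := S → rootsOfUnity q ℂ

/-- The direct sum of copies of the `q`-th roots of unity, as a subgroup of the product. -/
def finSuppSubgroup (S : Type) (q : ℕ) : Subgroup (Config S q) where
  carrier := {g | {x | g x ≠ 1}.Finite}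
  one_mem' := by simp
  mul_mem' := by
    intro a b ha hb
    refine (Set.Finite.union ha hb).subset ?_
    intro x hx
    by_contra hcon
    simp only [Set.mem_union, Set.mem_ofPred_eq, not_or, not_not] at hcon
    exact hx (by simp [hcon.1, hcon.2])
  inv_mem' := by
    intro a ha
    simpa using ha

/-- The direct sum of copies of the `q`-th roots of unity, a group with the discrete topology. -/
def SpinGroup (S : Type) (q : ℕ) : Type := finSuppSubgroup S q

namespace SpinGroup

variable {S : Type} {q : ℕ}

instance : CommGroup (SpinGroup S q) := inferInstanceAs (CommGroup (finSuppSubgroup S q))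

instance : TopologicalSpace (SpinGroup S q) := ⊥

instance : DiscreteTopology (SpinGroup S q) := ⟨rfl⟩

/-- The inclusion of the direct sum into the product. -/
def val : SpinGroup S q →* Config S q := (finSuppSubgroup S q).subtype

/-- The action on configurations, by sitewise multiplication. -/
def act (g : SpinGroup S q) (σ : Config S q) : Config S q := g.val * σ

theorem one_act (σ : Config S q) : (1 : SpinGroup S q).act σ = σ := by
  simp [act]

theorem mul_act (g h : SpinGroup S q) (σ : Config S q) : (g * h).act σ = g.act (h.act σ) := by
  simp [act, mul_assoc]

theorem continuous_act (g : SpinGroup S q) : Continuous g.act :=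
  continuous_const.mul continuous_id

end SpinGroup

/-- The transformation groupoid. The arrow `(σ, g)` has source `σ` and range `g σ`; composition is
`(g σ, h) ∘ (σ, g) = (σ, h g)`, and the inverse of `(σ, g)` is `(g σ, g⁻¹)`. The topology is the
product topology. -/
abbrev Arrow (S : Type) (q : ℕ) : Type := Config S q × SpinGroup S q

section Groupoid

variable {S : Type} {q : ℕ}

/-! ### Compactly supported functions on the groupoid -/

/-- The group elements `g` with `f (·, g) ≠ 0`. -/
def groupSupport (f : C_c(Arrow S q, ℂ)) : Set (SpinGroup S q) := {g | ∃ σ, f (σ, g) ≠ 0}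

theorem finite_groupSupport (f : C_c(Arrow S q, ℂ)) : (groupSupport f).Finite := by
  have h : IsCompact (Prod.snd '' tsupport f) :=
    f.hasCompactSupport.isCompact.image continuous_snd
  refine (h.finite_of_discrete).subset ?_
  rintro g ⟨σ, hσ⟩
  exact ⟨(σ, g), subset_tsupport _ hσ, rfl⟩

theorem eq_zero_of_notMem_groupSupport (f : C_c(Arrow S q, ℂ)) {g : SpinGroup S q}
    (hg : g ∉ groupSupport f) (σ : Config S q) : f (σ, g) = 0 := by
  by_contra h
  exact hg ⟨σ, h⟩

theorem continuous_slice (f : C_c(Arrow S q, ℂ)) (g : SpinGroup S q) :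
    Continuous fun σ => f (σ, g) :=
  f.continuous.comp (by fun_prop)

/-- A function on the groupoid that is continuous in the configuration and vanishes outside finitely
many group elements is continuous with compact support. -/
def mkCc [NeZero q] (F : Arrow S q → ℂ) (hF : ∀ g, Continuous fun σ => F (σ, g))
    (hs : {g | ∃ σ, F (σ, g) ≠ 0}.Finite) : C_c(Arrow S q, ℂ) where
  toFun := F
  continuous_toFun := continuous_prod_of_discrete_right.2 hF
  hasCompactSupport' := by
    refine HasCompactSupport.intro (K := Set.univ ×ˢ {g | ∃ σ, F (σ, g) ≠ 0})
      (isCompact_univ.prod hs.isCompact) ?_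
    rintro ⟨σ, g⟩ h
    by_contra hne
    exact h ⟨Set.mem_univ _, σ, hne⟩

@[simp] theorem mkCc_apply [NeZero q] (F : Arrow S q → ℂ) (hF : ∀ g, Continuous fun σ => F (σ, g))
    (hs : {g | ∃ σ, F (σ, g) ≠ 0}.Finite) (p : Arrow S q) : mkCc F hF hs p = F p := rfl

theorem conv_support_subset (f₁ f₂ : C_c(Arrow S q, ℂ)) (σ : Config S q) (g : SpinGroup S q) :
    (Function.support fun k : SpinGroup S q => f₁ (k.act σ, g * k⁻¹) * f₂ (σ, k)) ⊆
      (finite_groupSupport f₂).toFinset := by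
  intro k hk
  rw [Function.mem_support] at hk
  simp only [Set.Finite.coe_toFinset]
  exact ⟨σ, right_ne_zero_of_mul hk⟩

/-- The convolution product,
`(f₁ · f₂) (σ, g) = ∑ k, f₁ (k σ, g k⁻¹) f₂ (σ, k)`. -/
def convolution [NeZero q] (f₁ f₂ : C_c(Arrow S q, ℂ)) : C_c(Arrow S q, ℂ) :=
  mkCc (fun p => ∑ᶠ k : SpinGroup S q, f₁ (k.act p.1, p.2 * k⁻¹) * f₂ (p.1, k))
    (by
      intro g
      have h : (fun σ => ∑ᶠ k : SpinGroup S q, f₁ (k.act σ, g * k⁻¹) * f₂ (σ, k)) =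
          fun σ => ∑ k ∈ (finite_groupSupport f₂).toFinset,
            f₁ (k.act σ, g * k⁻¹) * f₂ (σ, k) := by
        funext σ
        exact finsum_eq_sum_of_support_subset _ (conv_support_subset f₁ f₂ σ g)
      change Continuous fun σ => ∑ᶠ k : SpinGroup S q, f₁ (k.act σ, g * k⁻¹) * f₂ (σ, k)
      rw [h]
      refine continuous_finsetSum _ fun k _ => ?_
      exact ((continuous_slice f₁ _).comp k.continuous_act).mul (continuous_slice f₂ k))
    (by
      refine ((finite_groupSupport f₁).image2 (· * ·) (finite_groupSupport f₂)).subset ?_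
      rintro g ⟨σ, hσ⟩
      obtain ⟨k, hk⟩ : ∃ k : SpinGroup S q, f₁ (k.act σ, g * k⁻¹) * f₂ (σ, k) ≠ 0 := by
        by_contra! hcon
        exact hσ (by simp [hcon])
      exact ⟨g * k⁻¹, ⟨_, left_ne_zero_of_mul hk⟩, k, ⟨_, right_ne_zero_of_mul hk⟩, by simp⟩)

/-- The involution, `f* (σ, g) = conj (f (g σ, g⁻¹))`. -/
def involution [NeZero q] (f : C_c(Arrow S q, ℂ)) : C_c(Arrow S q, ℂ) :=
  mkCc (fun p => star (f (p.2.act p.1, p.2⁻¹)))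
    (fun g => ((continuous_slice f g⁻¹).comp g.continuous_act).star)
    (by
      refine ((finite_groupSupport f).image (·⁻¹)).subset ?_
      rintro g ⟨σ, hσ⟩
      exact ⟨g⁻¹, ⟨g.act σ, by simpa using hσ⟩, by simp⟩)

open Classical in
/-- A scalar multiple of the indicator function of the unit space. -/
def scalarUnit [NeZero q] (c : ℂ) : C_c(Arrow S q, ℂ) :=
  mkCc (fun p => if p.2 = 1 then c else 0) (fun g => (continuous_const : Continuous fun _ : Config S q => if g = 1 then c else 0))
    (by
      refine (Set.finite_singleton (1 : SpinGroup S q)).subset ?_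
      rintro g ⟨σ, hσ⟩
      by_contra hg
      exact hσ (if_neg hg))

/-! ### The regular representation and the groupoid C*-algebra -/

/-- The Hilbert space of square summable functions on the groupoid, which is the direct sum over the
configurations `σ` of the spaces of square summable functions on the arrows with source `σ`. -/
abbrev RegSpace (S : Type) (q : ℕ) : Type := lp (fun _ : Arrow S q => ℂ) 2

/-- A bounded weight times a permutation of the coordinates acts boundedly. -/
theorem exists_weightedShift {I : Type} (w : I → ℂ) (C : ℝ) (hw : ∀ i, ‖w i‖ ≤ C) (e : I ≃ I) :
    ∃ T : lp (fun _ : I => ℂ) 2 →L[ℂ] lp (fun _ : I => ℂ) 2, ∀ ξ i, T ξ i = w i * ξ (e i) := by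
  have hp : 0 < (2 : ENNReal).toReal := by simp
  have hsum : ∀ ξ : lp (fun _ : I => ℂ) 2, Summable fun i => ‖ξ (e i)‖ ^ (2 : ENNReal).toReal :=
    fun ξ => (e.summable_iff (f := fun i => ‖ξ i‖ ^ (2 : ENNReal).toReal)).2
      ((lp.memℓp ξ).summable hp)
  have hle : ∀ (ξ : lp (fun _ : I => ℂ) 2) i, ‖w i * ξ (e i)‖ ^ (2 : ENNReal).toReal ≤
      |C| ^ (2 : ENNReal).toReal * ‖ξ (e i)‖ ^ (2 : ENNReal).toReal := by
    intro ξ i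
    rw [← Real.mul_rpow (abs_nonneg _) (norm_nonneg _), norm_mul]
    have := (hw i).trans (le_abs_self C)
    gcongr
  have hmem : ∀ ξ : lp (fun _ : I => ℂ) 2, Memℓp (fun i => w i * ξ (e i)) 2 := fun ξ =>
    memℓp_gen (Summable.of_nonneg_of_le (fun i => by positivity) (hle ξ)
      ((hsum ξ).mul_left _))
  refine ⟨LinearMap.mkContinuous
    { toFun := fun ξ => ⟨fun i => w i * ξ (e i), hmem ξ⟩
      map_add' := fun ξ η => by
        apply lp.ext
        funext i
        exact mul_add _ _ _
      map_smul' := fun c ξ => by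
        apply lp.ext
        funext i
        exact mul_left_comm _ _ _ } |C| ?_, fun ξ i => rfl⟩
  intro ξ
  refine lp.norm_le_of_tsum_le hp (by positivity) ?_
  rw [Real.mul_rpow (abs_nonneg _) (norm_nonneg _), lp.norm_rpow_eq_tsum hp,
    ← e.tsum_eq (fun i => ‖ξ i‖ ^ (2 : ENNReal).toReal), ← tsum_mul_left]
  exact Summable.tsum_le_tsum (hle ξ) ((hmem ξ).summable hp) ((hsum ξ).mul_left _)

theorem regRep_support_subset (f : C_c(Arrow S q, ℂ)) (ξ : Arrow S q → ℂ) (p : Arrow S q) :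
    (Function.support fun h : SpinGroup S q => f (h.act p.1, p.2 * h⁻¹) * ξ (p.1, h)) ⊆
      (((finite_groupSupport f).image fun k => k⁻¹ * p.2).toFinset : Set (SpinGroup S q)) := by
  intro h hh
  rw [Function.mem_support] at hh
  simp only [Set.Finite.coe_toFinset]
  exact ⟨p.2 * h⁻¹, ⟨_, left_ne_zero_of_mul hh⟩, by simp⟩

theorem exists_shift (f : C_c(Arrow S q, ℂ)) (k : SpinGroup S q) :
    ∃ T : RegSpace S q →L[ℂ] RegSpace S q, ∀ ξ p,
      T ξ p = f ((k⁻¹ * p.2).act p.1, k) *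
        ξ (((Equiv.refl (Config S q)).prodCongr (Equiv.mulLeft k⁻¹)) p) := by
  obtain ⟨C, hC⟩ := f.hasCompactSupport.exists_bound_of_continuous f.continuous
  exact exists_weightedShift (fun p : Arrow S q => f ((k⁻¹ * p.2).act p.1, k)) C (fun p => hC _)
    ((Equiv.refl (Config S q)).prodCongr (Equiv.mulLeft k⁻¹))

theorem sum_shift_apply (f : C_c(Arrow S q, ℂ))
    (T : SpinGroup S q → RegSpace S q →L[ℂ] RegSpace S q)
    (hT : ∀ k ξ p, T k ξ p = f ((k⁻¹ * p.2).act p.1, k) *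
        ξ (((Equiv.refl (Config S q)).prodCongr (Equiv.mulLeft k⁻¹)) p))
    (ξ : RegSpace S q) (p : Arrow S q) :
    (∑ k ∈ (finite_groupSupport f).toFinset, T k) ξ p =
      ∑ᶠ h : SpinGroup S q, f (h.act p.1, p.2 * h⁻¹) * ξ (p.1, h) := by
  rw [sum_apply, lp.coeFn_sum, Finset.sum_apply]
  rw [← finsum_comp_equiv ((Equiv.inv (SpinGroup S q)).trans (Equiv.mulRight p.2)),
    finsum_eq_sum_of_support_subset _ (s := (finite_groupSupport f).toFinset)]
  · refine Finset.sum_congr rfl fun k _ => ?_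
    rw [hT]
    have h1 : p.2 * (k⁻¹ * p.2)⁻¹ = k := by simp
    simp only [Equiv.trans_apply, Equiv.inv_apply, Equiv.coe_mulRight, h1]
    rfl
  · intro k hk
    rw [Function.mem_support] at hk
    simp only [Set.Finite.coe_toFinset]
    refine ⟨(k⁻¹ * p.2).act p.1, ?_⟩
    have := left_ne_zero_of_mul hk
    simpa using this

theorem exists_regRep (f : C_c(Arrow S q, ℂ)) :
    ∃ T : RegSpace S q →L[ℂ] RegSpace S q, ∀ ξ p,
      T ξ p = ∑ᶠ h : SpinGroup S q, f (h.act p.1, p.2 * h⁻¹) * ξ (p.1, h) := by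
  choose T hT using exists_shift f
  exact ⟨_, sum_shift_apply f T hT⟩

/-- The left regular representation,
`(π(f) ξ) (σ, g) = ∑ h, f (h σ, g h⁻¹) ξ (σ, h)`. -/
def regRep (f : C_c(Arrow S q, ℂ)) : RegSpace S q →L[ℂ] RegSpace S q :=
  LinearMap.mkContinuousOfExistsBound
    { toFun := fun ξ =>
        ⟨fun p => ∑ᶠ h : SpinGroup S q, f (h.act p.1, p.2 * h⁻¹) * ξ (p.1, h), by
          obtain ⟨T, hT⟩ := exists_regRep f
          have h := lp.memℓp (T ξ)
          rwa [funext (hT ξ)] at h⟩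
      map_add' := fun ξ η => by
        obtain ⟨T, hT⟩ := exists_regRep f
        apply lp.ext
        funext p
        have e : T (ξ + η) p = T ξ p + T η p := by
          rw [map_add]
          rfl
        exact ((hT _ p).symm.trans e).trans (congrArg₂ (· + ·) (hT ξ p) (hT η p))
      map_smul' := fun c ξ => by
        obtain ⟨T, hT⟩ := exists_regRep f
        apply lp.ext
        funext p
        have e : T (c • ξ) p = c * T ξ p := by
          rw [map_smul]
          rfl
        exact ((hT _ p).symm.trans e).trans (congrArg (c * ·) (hT ξ p)) }
    (by
      obtain ⟨T, hT⟩ := exists_regRep f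
      refine ⟨‖T‖, fun ξ => ?_⟩
      convert T.le_opNorm ξ using 2
      apply lp.ext
      funext p
      exact (hT ξ p).symm)

theorem regRep_apply (f : C_c(Arrow S q, ℂ)) (ξ : RegSpace S q) (p : Arrow S q) :
    regRep f ξ p = ∑ᶠ h : SpinGroup S q, f (h.act p.1, p.2 * h⁻¹) * ξ (p.1, h) := rfl

theorem regRep_add [NeZero q] (f₁ f₂ : C_c(Arrow S q, ℂ)) :
    regRep (f₁ + f₂) = regRep f₁ + regRep f₂ := by
  ext ξ p
  rw [add_apply, lp.coeFn_add, Pi.add_apply, regRep_apply, regRep_apply,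
    regRep_apply, ← finsum_add_distrib]
  · simp only [CompactlySupportedContinuousMap.add_apply, add_mul]
  · exact (Finset.finite_toSet _).subset (regRep_support_subset f₁ ξ p)
  · exact (Finset.finite_toSet _).subset (regRep_support_subset f₂ ξ p)

theorem regRep_scalarUnit [NeZero q] (c : ℂ) :
    regRep (scalarUnit c : C_c(Arrow S q, ℂ)) = algebraMap ℂ _ c := by
  ext ξ p
  rw [regRep_apply, finsum_eq_single _ p.2]
  · simp [scalarUnit, Algebra.algebraMap_eq_smul_one]
  · intro h hne
    have : p.2 * h⁻¹ ≠ 1 := fun h1 => hne (mul_inv_eq_one.1 h1).symm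
    simp [scalarUnit, this]

theorem finsum_comm_of_support {α β : Type} (F : α → β → ℂ) (A : Finset α) (B : Finset β)
    (h : ∀ a b, F a b ≠ 0 → a ∈ A ∧ b ∈ B) :
    ∑ᶠ a, ∑ᶠ b, F a b = ∑ᶠ b, ∑ᶠ a, F a b := by
  have h1 : ∀ a, ∑ᶠ b, F a b = ∑ b ∈ B, F a b := fun a =>
    finsum_eq_sum_of_support_subset _ fun b hb => (h a b hb).2
  have h2 : ∀ b, ∑ᶠ a, F a b = ∑ a ∈ A, F a b := fun b =>
    finsum_eq_sum_of_support_subset _ fun a ha => (h a b ha).1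
  simp only [h1, h2]
  rw [finsum_eq_sum_of_support_subset (s := A), finsum_eq_sum_of_support_subset (s := B),
    Finset.sum_comm]
  · intro b hb
    obtain ⟨a, -, ha⟩ := Finset.exists_ne_zero_of_sum_ne_zero hb
    exact (h a b ha).2
  · intro a ha
    obtain ⟨b, -, hb⟩ := Finset.exists_ne_zero_of_sum_ne_zero ha
    exact (h a b hb).1

theorem regRep_convolution [NeZero q] (f₁ f₂ : C_c(Arrow S q, ℂ)) :
    regRep (convolution f₁ f₂) = regRep f₁ * regRep f₂ := by
  classical
  ext ξ p
  rw [mul_apply_eq_comp, regRep_apply, regRep_apply]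
  have hfin : ∀ l : SpinGroup S q, f₁ (l.act p.1, p.2 * l⁻¹) * regRep f₂ ξ (p.1, l) =
      ∑ᶠ h : SpinGroup S q, f₁ (l.act p.1, p.2 * l⁻¹) *
        (f₂ (h.act p.1, l * h⁻¹) * ξ (p.1, h)) := by
    intro l
    rw [regRep_apply, mul_finsum]
  have hconv : ∀ h : SpinGroup S q,
      convolution f₁ f₂ (h.act p.1, p.2 * h⁻¹) * ξ (p.1, h) =
      ∑ᶠ l : SpinGroup S q, f₁ (l.act p.1, p.2 * l⁻¹) *
        (f₂ (h.act p.1, l * h⁻¹) * ξ (p.1, h)) := by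
    intro h
    rw [convolution, mkCc_apply, finsum_mul]
    rw [← finsum_comp_equiv (Equiv.mulRight h⁻¹)]
    refine finsum_congr fun l => ?_
    simp [← SpinGroup.mul_act, mul_assoc]
  simp only [hfin, hconv]
  refine finsum_comm_of_support _
    (((finite_groupSupport f₁).image2 (fun a b => b⁻¹ * (a⁻¹ * p.2))
      (finite_groupSupport f₂)).toFinset)
    (((finite_groupSupport f₁).image fun k => k⁻¹ * p.2).toFinset) ?_
  intro h l hne
  have h1 := left_ne_zero_of_mul hne
  have h2 := left_ne_zero_of_mul (right_ne_zero_of_mul hne)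
  rw [Set.Finite.mem_toFinset, Set.Finite.mem_toFinset]
  exact ⟨⟨p.2 * l⁻¹, ⟨_, h1⟩, l * h⁻¹, ⟨_, h2⟩, by simp⟩, p.2 * l⁻¹, ⟨_, h1⟩, by simp⟩

theorem star_weightedShift {I : Type} (w : I → ℂ) (e : I ≃ I)
    (T T' : lp (fun _ : I => ℂ) 2 →L[ℂ] lp (fun _ : I => ℂ) 2)
    (hT : ∀ ξ i, T ξ i = w i * ξ (e i))
    (hT' : ∀ ξ i, T' ξ i = star (w (e.symm i)) * ξ (e.symm i)) : star T = T' := by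
  rw [ContinuousLinearMap.star_eq_adjoint]
  symm
  rw [ContinuousLinearMap.eq_adjoint_iff]
  intro ξ η
  rw [lp.inner_eq_tsum, lp.inner_eq_tsum, ← e.tsum_eq]
  refine tsum_congr fun i => ?_
  rw [hT, hT']
  simp only [Equiv.symm_apply_apply, RCLike.inner_apply, map_mul, RCLike.star_def,
    RingHomCompTriple.comp_apply, RingHom.id_apply]
  ring

theorem regRep_involution [NeZero q] (f : C_c(Arrow S q, ℂ)) :
    regRep (involution f) = star (regRep f) := by
  choose T hT using exists_shift f
  choose T' hT' using exists_shift (involution f)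
  have h1 : regRep f = ∑ k ∈ (finite_groupSupport f).toFinset, T k := by
    ext ξ p
    rw [sum_shift_apply f T hT, regRep_apply]
  have h2 : regRep (involution f) =
      ∑ k ∈ (finite_groupSupport (involution f)).toFinset, T' k := by
    ext ξ p
    rw [sum_shift_apply _ T' hT', regRep_apply]
  rw [h1, h2, star_sum]
  refine Finset.sum_nbij' (·⁻¹) (·⁻¹) ?_ ?_ (by simp) (by simp) ?_
  · intro k hk
    rw [Set.Finite.mem_toFinset] at hk ⊢
    obtain ⟨σ, hσ⟩ := hk
    exact ⟨k.act σ, by simpa [involution] using hσ⟩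
  · intro k hk
    rw [Set.Finite.mem_toFinset] at hk ⊢
    obtain ⟨σ, hσ⟩ := hk
    exact ⟨k.act σ, by simpa [involution, ← SpinGroup.mul_act, SpinGroup.one_act] using hσ⟩
  · intro k _
    symm
    refine star_weightedShift _ _ _ _ (hT k⁻¹) fun ξ p => ?_
    rw [hT']
    simp [involution, ← SpinGroup.mul_act, Equiv.prodCongr]

/-- The image of the convolution algebra of compactly supported continuous functions under the left
regular representation. -/
def regImage (S : Type) (q : ℕ) [NeZero q] :
    StarSubalgebra ℂ (RegSpace S q →L[ℂ] RegSpace S q) where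
  carrier := Set.range (regRep : C_c(Arrow S q, ℂ) → _)
  mul_mem' := by
    rintro _ _ ⟨f₁, rfl⟩ ⟨f₂, rfl⟩
    exact ⟨_, regRep_convolution f₁ f₂⟩
  add_mem' := by
    rintro _ _ ⟨f₁, rfl⟩ ⟨f₂, rfl⟩
    exact ⟨_, regRep_add f₁ f₂⟩
  algebraMap_mem' := fun c => ⟨_, regRep_scalarUnit c⟩
  star_mem' := by
    rintro _ ⟨f, rfl⟩
    exact ⟨_, regRep_involution f⟩

/-- The (reduced) groupoid C*-algebra: the norm closure of the image of the left regular
representation, that is, the completion of the convolution algebra in the norm `‖π(f)‖`. -/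
def reducedCStar (S : Type) (q : ℕ) [NeZero q] :
    StarSubalgebra ℂ (RegSpace S q →L[ℂ] RegSpace S q) :=
  (regImage S q).topologicalClosure

end Groupoid

/-! ### Local functions -/

section Quasilocal

variable {S : Type} {q : ℕ}

/-- Restriction of a group element to a set of sites. -/
def SpinGroup.restrict (Λ : Finset S) (g : SpinGroup S q) : SpinGroup Λ q :=
  ⟨fun x => g.val x, Set.toFinite _⟩

open Classical in
/-- The inclusion of functions on the groupoid of a finite set `Λ` of sites,
`(σ, g) ↦ f (σ_Λ, g_Λ)` if `g` is trivial off `Λ`, and `0` otherwise. -/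
def extendLocal [NeZero q] (Λ : Finset S) (f : C_c(Arrow Λ q, ℂ)) : C_c(Arrow S q, ℂ) :=
  mkCc (fun p => if ∀ x, x ∉ Λ → p.2.val x = 1 then
      f (fun x => p.1 x, p.2.restrict Λ) else 0)
    (by
      intro g
      by_cases hg : ∀ x, x ∉ Λ → g.val x = 1
      · have h : Continuous fun σ : Config S q => fun x : Λ => σ x := by fun_prop
        have h2 : Continuous fun σ : Config S q => f (fun x : Λ => σ x, g.restrict Λ) :=
          (continuous_slice f (g.restrict Λ)).comp h
        simpa only [if_pos hg] using h2
      · simpa only [if_neg hg] using (continuous_const : Continuous fun _ : Config S q => (0 : ℂ)))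
    (by
      have hfin : (Set.univ : Set (Λ → rootsOfUnity q ℂ)).Finite := Set.toFinite _
      refine Set.Finite.of_finite_image (f := fun g : SpinGroup S q => fun x : Λ => g.val x)
        (hfin.subset (Set.subset_univ _)) ?_
      rintro g ⟨σ, hσ⟩ h ⟨ω, hω⟩ heq
      have hg : ∀ x, x ∉ Λ → g.val x = 1 := by
        by_contra hcon
        exact hσ (if_neg hcon)
      have hh : ∀ x, x ∉ Λ → h.val x = 1 := by
        by_contra hcon
        exact hω (if_neg hcon)
      apply Subtype.ext
      funext x
      by_cases hx : x ∈ Λ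
      · exact congrFun heq ⟨x, hx⟩
      · exact (hg x hx).trans (hh x hx).symm)

end Quasilocal

/-- The algebra of observables: the groupoid C*-algebra of the lattice `ℤ ^ d`. -/
abbrev Observables (d q : ℕ) [NeZero q] : Type := reducedCStar (Fin d → ℤ) q

section Dynamics

variable {d q : ℕ} [NeZero q]

/-- The local operators of a finite set `Λ` of sites: the groupoid C*-algebra of `Λ`, which consists
of all functions on the (finite) groupoid of `Λ`, included in the algebra of observables. -/
def localOperators (d q : ℕ) [NeZero q] (Λ : Finset (Fin d → ℤ)) : Set (Observables d q) :=
  {a | ∃ f : C_c(Arrow Λ q, ℂ),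
    (a : RegSpace (Fin d → ℤ) q →L[ℂ] RegSpace (Fin d → ℤ) q) = regRep (extendLocal Λ f)}

/-- An interaction: a self-adjoint local operator `φ_X` for every finite set `X` of sites. -/
structure Interaction (d q : ℕ) [NeZero q] where
  toFun : Finset (Fin d → ℤ) → Observables d q
  selfAdjoint : ∀ X, star (toFun X) = toFun X
  isLocal : ∀ X, toFun X ∈ localOperators d q X

namespace Interaction

instance : CoeFun (Interaction d q) fun _ => Finset (Fin d → ℤ) → Observables d q :=
  ⟨Interaction.toFun⟩

/-- The norm `∑_{n ≥ 0} e^{lam n} sup_x ∑_{X ∋ x, |X| = n + 1} ‖φ_X‖`, possibly infinite. -/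
def expNorm (φ : Interaction d q) (lam : ℝ) : ENNReal :=
  ∑' n : ℕ, ENNReal.ofReal (Real.exp (lam * n)) *
    ⨆ x : Fin d → ℤ, ∑' X : {X : Finset (Fin d → ℤ) // x ∈ X ∧ X.card = n + 1}, ‖φ X‖ₑ

/-- The Hamiltonian `H_Λ = ∑_{X ⊆ Λ} φ_X`. -/
def hamiltonian (φ : Interaction d q) (Λ : Finset (Fin d → ℤ)) : Observables d q :=
  ∑ X ∈ Λ.powerset, φ X

/-- The local dynamics `τ_t^Λ(f) = e^{i t H_Λ} f e^{-i t H_Λ}`. -/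
def localDynamics (φ : Interaction d q) (Λ : Finset (Fin d → ℤ)) (t : ℝ) (f : Observables d q) :
    Observables d q :=
  NormedSpace.exp ((Complex.I * (t : ℂ)) • φ.hamiltonian Λ) * f *
    NormedSpace.exp (-((Complex.I * (t : ℂ)) • φ.hamiltonian Λ))

/-- `D` is the operator whose domain consists of all local operators, and which is given by the
absolutely convergent series `D f = i ∑_{X ∩ Λ ≠ ∅} [φ_X, f]` for all finite `Λ` and all local
operators `f` of `Λ`. -/
def IsDerivationOf (φ : Interaction d q) (D : Observables d q →ₗ.[ℂ] Observables d q) : Prop :=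
  (∀ f, f ∈ D.domain ↔ ∃ Λ, f ∈ localOperators d q Λ) ∧
  ∀ (Λ : Finset (Fin d → ℤ)) (f : D.domain), (f : Observables d q) ∈ localOperators d q Λ →
    (Summable fun X : {X : Finset (Fin d → ℤ) // ∃ x ∈ X, x ∈ Λ} =>
      ‖φ X * (f : Observables d q) - (f : Observables d q) * φ X‖) ∧
    D f = Complex.I • ∑' X : {X : Finset (Fin d → ℤ) // ∃ x ∈ X, x ∈ Λ},
      (φ X * (f : Observables d q) - (f : Observables d q) * φ X)

end Interaction

end Dynamics

section Generators

variable {A : Type} [NormedRing A] [StarRing A] [NormedAlgebra ℂ A]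

/-- A linear operator `D` on a *-algebra is a *-derivation: its domain is stable under products and
the involution, `D (f g) = (D f) g + f (D g)`, and `D (f*) = (D f)*`. -/
def IsStarDerivation (D : A →ₗ.[ℂ] A) : Prop :=
  (∀ f g : D.domain, ∃ h : (f : A) * (g : A) ∈ D.domain,
    D ⟨(f : A) * (g : A), h⟩ = D f * (g : A) + (f : A) * D g) ∧
  ∀ f : D.domain, ∃ h : star (f : A) ∈ D.domain, D ⟨star (f : A), h⟩ = star (D f)

/-- A strongly continuous one-parameter group of *-automorphisms. -/
structure IsAutomorphismGroup (τ : ℝ → A ≃⋆ₐ[ℂ] A) : Prop where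
  zero : ∀ f, τ 0 f = f
  add : ∀ s t f, τ (s + t) f = τ s (τ t f)
  continuous : ∀ f, Continuous fun t => τ t f

/-- `D` is the infinitesimal generator of `τ`: `f` is in the domain of `D`, with `D f = g`, exactly
if `t ↦ τ t f` is differentiable at `0` with derivative `g`. -/
def IsGeneratorOf (D : A →ₗ.[ℂ] A) (τ : ℝ → A ≃⋆ₐ[ℂ] A) : Prop :=
  ∀ f g : A, (f, g) ∈ D.graph ↔ HasDerivAt (fun t : ℝ => τ t f) g 0

end Generators

end

/-!
The dynamics is constructed in an abstract setting: a C*-algebra `A` with closed `*`-subalgebras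
`A_Λ` for the finite sets `Λ` of sites, increasing in `Λ`, commuting for disjoint sets, with dense
union (`QuasilocalNet`), and self-adjoint `φ_X ∈ A_X` with `∑_{X ∋ x} e^{lam (|X| - 1)} ‖φ_X‖ ≤ C`
for all sites `x` (`DecayingInteraction`). Write `δ_Λ f = i [H_Λ, f]`, so that
`τ_t^Λ = e^{t δ_Λ}`.

Everything rests on one estimate. If `f` is a finite sum of elements of the `A_Y` with norms at
most `m Y`, then `δ_Λ f` is a sum of this kind with bounds `majorantStep m`, which do not depend
on `Λ`. The total mass of `m` with weights `e^{ν |Y|}` controls that of `majorantStep m` with a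
smaller `ν`, at a cost inversely proportional to the loss in `ν` (`expMass_majorantStep_le`).
Distributing the loss `lam` evenly over `n` steps, the `n`-th commutator is bounded by a constant
to the power `n` times `n ^ n`, so the exponential series converges up to a time `T > 0`
(`exists_pos_tsum_expMass_lt_top`). Hence for local `f` there are numbers `b_X` with `∑_X b_X < ∞`
and `‖[φ_X, τ_t^Λ f]‖ ≤ b_X` for all `Λ` and all `|t| ≤ T` (`enorm_commutatorCLM_localFlow_le`):
the sum over `X ⊄ Λ` of these commutators tends to `0`, uniformly in `t`. This tail has two uses.

* For `Λ ⊆ Λ'` it bounds `(δ_Λ - δ_Λ') τ_t^Λ f`, so that interpolating between the two dynamics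
  shows that `τ_t^Λ f` is uniformly Cauchy for `|t| ≤ T` (`uniformCauchySeqOn_localFlow`). As the
  `τ^Λ` are isometric groups, convergence extends to all of `A` and to all times
  (`exists_limit_automorphismGroup`).
* It bounds `D (τ_t^Λ f) - δ_Λ (τ_t^Λ f) = D (τ_t^Λ f) - τ_t^Λ (δ_Λ f)`, so that
  `(τ_t f, τ_t (D f))` is a limit of points of the graph of `D` (`mem_closure_graph_derivation`).

Since `(d/dt) τ_t f = τ_t (D f)` for local `f`, a property that passes to limits in the graph, `D`
is closable and its closure is contained in the generator. Conversely, if `f` is in the domain of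
the generator, then `(ε⁻¹ ∫₀^ε τ_s f ds, ε⁻¹ (τ_ε f - f))` is in the closure of the graph of `D`
for `0 < ε ≤ T`, by the second use of the tail and density, and letting `ε` tend to `0` shows that the
closure of `D` is the whole generator (`isClosable_and_isGeneratorOf_closure`).

For the groupoid C*-algebra, `A_Λ` consists of the functions that depend only on the configuration
in `Λ` and are supported on the group elements that are trivial off `Λ` (`IsLocalFun`). The `A_Λ`
are finite-dimensional, hence closed; their union is dense because a continuous function on the
compact configuration space is determined by finitely many sites up to a small error
(`exists_finset_forall_dist_lt`).
-/

open Filter Topology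
open scoped CompactlySupported

/-! ### Limits of one-parameter groups of automorphisms -/

section FlowLimit

variable {A : Type} [NormedRing A] [StarRing A] [NormedAlgebra ℂ A]

theorem uniformCauchySeqOn_iff_eventually_dist_lt {ι α X : Type*} [PseudoMetricSpace X]
    {F : ι → α → X} {l : Filter ι} {s : Set α} :
    UniformCauchySeqOn F l s ↔
      ∀ ε > 0, ∀ᶠ m : ι × ι in l ×ˢ l, ∀ x ∈ s, dist (F m.1 x) (F m.2 x) < ε := by
  constructor
  · intro h ε hε
    exact h _ (Metric.dist_mem_uniformity hε)
  · intro h u hu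
    obtain ⟨ε, hε, hsub⟩ := Metric.mem_uniformity_dist.1 hu
    filter_upwards [h ε hε] with m hm x hx using hsub (hm x hx)

variable {ι : Type*} {l : Filter ι} {σ : ι → ℝ → A ≃⋆ₐ[ℂ] A}

theorem dist_map_eq_of_norm_map {τ : A ≃⋆ₐ[ℂ] A} (h : ∀ f, ‖τ f‖ = ‖f‖) (f g : A) :
    dist (τ f) (τ g) = dist f g := by
  rw [dist_eq_norm, dist_eq_norm, ← map_sub, h]

theorem uniformCauchySeqOn_of_dense (hnorm : ∀ i t f, ‖σ i t f‖ = ‖f‖) {S : Set A} (hS : Dense S)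
    {K : Set ℝ} (h : ∀ f ∈ S, UniformCauchySeqOn (fun i t => σ i t f) l K) (f : A) :
    UniformCauchySeqOn (fun i t => σ i t f) l K := by
  rw [uniformCauchySeqOn_iff_eventually_dist_lt]
  intro ε hε
  obtain ⟨g, hg, hfg⟩ := hS.exists_dist_lt f (show 0 < ε / 3 by positivity)
  filter_upwards [uniformCauchySeqOn_iff_eventually_dist_lt.1 (h g hg) (ε / 3) (by positivity)]
    with m hm t ht
  have h1 := dist_map_eq_of_norm_map (hnorm m.1 t) f g
  have h2 := dist_map_eq_of_norm_map (hnorm m.2 t) g f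
  rw [dist_comm g f] at h2
  have h3 := dist_triangle4 (σ m.1 t f) (σ m.1 t g) (σ m.2 t g) (σ m.2 t f)
  have h4 := hm t ht
  linarith

/-- If the orbits of all elements are uniformly Cauchy near time `0`, then convergence at a time `u`
propagates to a neighbourhood of `u`, because `σ_t f = σ_{t - u} (σ_u f)` and `σ_u f` is close to a
fixed element. -/
theorem uniformCauchySeqOn_of_tendsto (hσ : ∀ i, IsAutomorphismGroup (σ i))
    (hnorm : ∀ i t f, ‖σ i t f‖ = ‖f‖) {K : Set ℝ}
    (h : ∀ f, UniformCauchySeqOn (fun i t => σ i t f) l K) {f g : A} {u : ℝ}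
    (hu : Tendsto (fun i => σ i u f) l (𝓝 g)) :
    UniformCauchySeqOn (fun i t => σ i t f) l {t | t - u ∈ K} := by
  rw [uniformCauchySeqOn_iff_eventually_dist_lt]
  intro ε hε
  have hlim := Metric.tendsto_nhds.1 hu (ε / 3) (by positivity)
  filter_upwards [uniformCauchySeqOn_iff_eventually_dist_lt.1 (h g) (ε / 3) (by positivity),
    hlim.prod_mk hlim] with m hm hm' t ht
  have key : ∀ i, σ i t f = σ i (t - u) (σ i u f) := fun i => by
    rw [← (hσ i).add, sub_add_cancel]
  have h1 := dist_map_eq_of_norm_map (hnorm m.1 (t - u)) (σ m.1 u f) g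
  have h2 := dist_map_eq_of_norm_map (hnorm m.2 (t - u)) g (σ m.2 u f)
  rw [dist_comm g] at h2
  have h3 := dist_triangle4 (σ m.1 t f) (σ m.1 (t - u) g) (σ m.2 (t - u) g) (σ m.2 t f)
  have h4 := hm (t - u) ht
  rw [key, key] at h3 ⊢
  linarith [hm'.1, hm'.2]

theorem tendsto_map_of_tendsto (hnorm : ∀ i t f, ‖σ i t f‖ = ‖f‖) {t : ℝ} {a : ι → A} {g b : A}
    (ha : Tendsto a l (𝓝 g)) (hg : Tendsto (fun i => σ i t g) l (𝓝 b)) :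
    Tendsto (fun i => σ i t (a i)) l (𝓝 b) := by
  rw [tendsto_iff_dist_tendsto_zero] at ha hg ⊢
  refine squeeze_zero (fun _ => dist_nonneg) (fun i => ?_) (by simpa using ha.add hg)
  refine (dist_triangle _ (σ i t g) _).trans_eq ?_
  rw [dist_map_eq_of_norm_map (hnorm i t)]

variable [CompleteSpace A]

theorem exists_tendsto_of_uniformCauchySeqOn_Icc [l.NeBot] (hσ : ∀ i, IsAutomorphismGroup (σ i))
    (hnorm : ∀ i t f, ‖σ i t f‖ = ‖f‖) {T : ℝ} (hT : 0 < T)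
    (h : ∀ f, UniformCauchySeqOn (fun i t => σ i t f) l (Set.Icc (-T) T)) (u : ℝ) (f : A) :
    ∃ g, Tendsto (fun i => σ i u f) l (𝓝 g) := by
  obtain ⟨n, hn⟩ := exists_nat_gt (|u| / T)
  have hn0 : (0 : ℝ) < n := (by positivity : 0 ≤ |u| / T).trans_lt hn
  set v : ℝ := u / n with hv
  have hvT : v ∈ Set.Icc (-T) T := by
    rw [Set.mem_Icc, ← abs_le, hv, abs_div, abs_of_pos hn0, div_le_iff₀ hn0]
    rw [div_lt_iff₀ hT] at hn
    linarith
  have main : ∀ m : ℕ, ∃ g, Tendsto (fun i => σ i (m * v) f) l (𝓝 g) := by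
    intro m
    induction m with
    | zero =>
      refine ⟨f, tendsto_const_nhds.congr fun i => ?_⟩
      rw [Nat.cast_zero, zero_mul, (hσ i).zero]
    | succ m ih =>
      obtain ⟨g, hg⟩ := ih
      exact CompleteSpace.complete
        ((uniformCauchySeqOn_of_tendsto hσ hnorm h hg).cauchy_map (x := (m + 1 : ℕ) * v)
          (by rw [Set.mem_ofPred_eq]; convert hvT using 1; push_cast; ring))
  obtain ⟨g, hg⟩ := main n
  refine ⟨g, ?_⟩
  rwa [hv, mul_div_cancel₀ _ hn0.ne'] at hg

variable [ContinuousStar A]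

/-- A net of isometric one-parameter groups of `*`-automorphisms whose orbits of elements of a dense
set are uniformly Cauchy on one interval around `0` converges, uniformly on all compact sets of
times, to a one-parameter group of `*`-automorphisms. -/
theorem exists_limit_automorphismGroup [l.NeBot] (hσ : ∀ i, IsAutomorphismGroup (σ i))
    (hnorm : ∀ i t f, ‖σ i t f‖ = ‖f‖) {S : Set A} (hS : Dense S) {T : ℝ} (hT : 0 < T)
    (hcauchy : ∀ f ∈ S, UniformCauchySeqOn (fun i t => σ i t f) l (Set.Icc (-T) T)) :
    ∃ τ : ℝ → A ≃⋆ₐ[ℂ] A, IsAutomorphismGroup τ ∧ (∀ t f, ‖τ t f‖ = ‖f‖) ∧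
      ∀ f K, IsCompact K → TendstoUniformlyOn (fun i t => σ i t f) (fun t => τ t f) l K := by
  have h := uniformCauchySeqOn_of_dense hnorm hS hcauchy
  choose θ hθ using exists_tendsto_of_uniformCauchySeqOn_Icc hσ hnorm hT h
  have hzero : ∀ f, θ 0 f = f := fun f =>
    tendsto_nhds_unique (hθ 0 f) (tendsto_const_nhds.congr fun i => ((hσ i).zero f).symm)
  have hadd : ∀ s t f, θ (s + t) f = θ s (θ t f) := fun s t f =>
    tendsto_nhds_unique (hθ (s + t) f)
      ((tendsto_map_of_tendsto hnorm (hθ t f) (hθ s _)).congr fun i => ((hσ i).add s t f).symm)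
  let τ : ℝ → A ≃⋆ₐ[ℂ] A := fun t =>
    { toFun := θ t
      invFun := θ (-t)
      left_inv := fun f => by rw [← hadd, neg_add_cancel, hzero]
      right_inv := fun f => by rw [← hadd, add_neg_cancel, hzero]
      map_mul' := fun f g => tendsto_nhds_unique (hθ t _)
        (((hθ t f).mul (hθ t g)).congr fun i => (map_mul (σ i t) f g).symm)
      map_add' := fun f g => tendsto_nhds_unique (hθ t _)
        (((hθ t f).add (hθ t g)).congr fun i => (map_add (σ i t) f g).symm)
      map_star' := fun f => tendsto_nhds_unique (hθ t _)
        ((hθ t f).star.congr fun i => (map_star (σ i t) f).symm)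
      map_smul' := fun c f => tendsto_nhds_unique (hθ t _)
        (((hθ t f).const_smul c).congr fun i => (map_smul (σ i t) c f).symm) }
  have hloc : ∀ f, TendstoLocallyUniformly (fun i t => σ i t f) (fun t => τ t f) l := by
    intro f u hu t
    refine ⟨Set.Icc (t - T) (t + T), Icc_mem_nhds (by linarith) (by linarith), ?_⟩
    refine ((uniformCauchySeqOn_of_tendsto hσ hnorm h (hθ t f)).tendstoUniformlyOn_of_tendsto
      (fun s _ => hθ s f) u hu).mono fun i hi s hs => hi s ?_
    exact ⟨by linarith [hs.1], by linarith [hs.2]⟩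
  refine ⟨τ, ⟨hzero, hadd, fun f => ?_⟩, fun t f => ?_, fun f => ?_⟩
  · exact (hloc f).continuous (Eventually.of_forall fun i => (hσ i).continuous f).frequently
  · refine tendsto_nhds_unique (hθ t f).norm ?_
    simp [hnorm]
  · exact tendstoLocallyUniformly_iff_forall_isCompact.1 (hloc f)

end FlowLimit

/-! ### Closability and generators -/

section Generator

variable {A : Type} [NormedRing A] [StarRing A] [NormedAlgebra ℂ A]

/-- The set of pairs `(f, g)` for which the orbit of `f` is differentiable with derivative `τ_t g`
at every time `t` contains the limits of its points. -/
theorem hasDerivAt_of_mem_closure {τ : ℝ → A ≃⋆ₐ[ℂ] A} (hnorm : ∀ t f, ‖τ t f‖ = ‖f‖)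
    {P : Set (A × A)} (hP : ∀ p ∈ P, ∀ t, HasDerivAt (fun s : ℝ => τ s p.1) (τ t p.2) t) {p : A × A}
    (hp : p ∈ closure P) (t : ℝ) : HasDerivAt (fun s : ℝ => τ s p.1) (τ t p.2) t := by
  obtain ⟨u, huP, hu⟩ := mem_closure_iff_seq_limit.1 hp
  have h1 : Tendsto (fun n => (u n).1) atTop (𝓝 p.1) := (continuous_fst.tendsto p).comp hu
  have h2 : Tendsto (fun n => (u n).2) atTop (𝓝 p.2) := (continuous_snd.tendsto p).comp hu
  refine hasDerivAt_of_tendstoLocallyUniformlyOn (l := atTop) (s := Set.univ)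
    (f := fun n s => τ s (u n).1) (f' := fun n s => τ s (u n).2) (g' := fun s => τ s p.2)
    isOpen_univ ?_ ?_ ?_ (Set.mem_univ t)
  · refine (TendstoUniformlyOn.tendstoLocallyUniformlyOn ?_)
    rw [Metric.tendstoUniformlyOn_iff]
    intro ε hε
    filter_upwards [Metric.tendsto_nhds.1 h2 ε hε] with n hn s _
    rwa [dist_map_eq_of_norm_map (hnorm s), dist_comm]
  · exact Eventually.of_forall fun n s _ => hP _ (huP n) s
  · intro s _
    rw [tendsto_iff_dist_tendsto_zero] at h1 ⊢
    simpa only [dist_map_eq_of_norm_map (hnorm s)] using h1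

theorem LinearPMap.isClosable_of_forall_mem_closure {E : Type*} [NormedAddCommGroup E]
    [NormedSpace ℂ E] (D : E →ₗ.[ℂ] E)
    (h : ∀ g : E, ((0 : E), g) ∈ D.graph.topologicalClosure → g = 0) : D.IsClosable := by
  refine ⟨D.graph.topologicalClosure.toLinearPMap, ?_⟩
  rw [Submodule.toLinearPMap_graph_eq]
  rintro ⟨x, y⟩ hxy (rfl : x = 0)
  exact h y hxy

theorem integral_orbit_mem_graph_closure_of_dense {τ : ℝ → A ≃⋆ₐ[ℂ] A} (hτ : IsAutomorphismGroup τ)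
    (hnorm : ∀ t f, ‖τ t f‖ = ‖f‖) (D : A →ₗ.[ℂ] A) (hD : Dense (D.domain : Set A)) {ε : ℝ}
    (h : ∀ f : D.domain,
      (∫ s in (0 : ℝ)..ε, τ s f, τ ε f - f) ∈ D.graph.topologicalClosure) (f : A) :
    (∫ s in (0 : ℝ)..ε, τ s f, τ ε f - f) ∈ D.graph.topologicalClosure := by
  obtain ⟨u, huD, hu⟩ := mem_closure_iff_seq_limit.1 (hD f)
  refine D.graph.isClosed_topologicalClosure.mem_of_tendsto
    (f := fun n => (∫ s in (0 : ℝ)..ε, τ s (u n), τ ε (u n) - u n)) (b := atTop) ?_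
    (Eventually.of_forall fun n => h ⟨u n, huD n⟩)
  refine Tendsto.prodMk_nhds ?_ (Tendsto.sub ?_ hu)
  · rw [tendsto_iff_dist_tendsto_zero] at hu ⊢
    refine squeeze_zero (fun _ => dist_nonneg) (fun n => ?_) (by simpa using hu.mul_const |ε|)
    rw [dist_eq_norm, ← intervalIntegral.integral_sub
      ((hτ.continuous _).intervalIntegrable _ _) ((hτ.continuous _).intervalIntegrable _ _)]
    have hle : ∀ s ∈ Set.uIoc 0 ε, ‖τ s (u n) - τ s f‖ ≤ dist (u n) f := fun s _ => by
      rw [← dist_eq_norm, dist_map_eq_of_norm_map (hnorm s)]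
    simpa using intervalIntegral.norm_integral_le_of_norm_le_const hle
  · rw [tendsto_iff_dist_tendsto_zero] at hu ⊢
    simpa only [dist_map_eq_of_norm_map (hnorm ε)] using hu

variable [CompleteSpace A]

theorem integral_orbit_mem_graph_closure {τ : ℝ → A ≃⋆ₐ[ℂ] A} (hτ : IsAutomorphismGroup τ)
    (D : A →ₗ.[ℂ] A)
    (hderiv : ∀ (f : D.domain) t, HasDerivAt (fun s : ℝ => τ s f) (τ t (D f)) t) {ε : ℝ}
    (hε : 0 < ε)
    (hinv : ∀ (f : D.domain), ∀ t ∈ Set.Icc 0 ε, (τ t f, τ t (D f)) ∈ D.graph.topologicalClosure)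
    (f : D.domain) :
    (∫ s in (0 : ℝ)..ε, τ s f, τ ε f - f) ∈ D.graph.topologicalClosure := by
  set G := D.graph.topologicalClosure with hG
  have hc : Continuous fun s => (τ s (f : A), τ s (D f)) :=
    (hτ.continuous f).prodMk (hτ.continuous (D f))
  have hint : ∫ s in (0 : ℝ)..ε, (τ s (f : A), τ s (D f)) =
      (∫ s in (0 : ℝ)..ε, τ s f, τ ε f - f) := by
    rw [intervalIntegral.integral_eq_sub_of_hasDerivAt
      (f := fun s => (∫ r in (0 : ℝ)..s, τ r f, τ s f)) (fun s _ => ?_) (hc.intervalIntegrable _ _)]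
    · simp [hτ.zero]
    · exact ((hτ.continuous f).integral_hasStrictDerivAt 0 s).hasDerivAt.prodMk (hderiv f s)
  rw [← hint, intervalIntegral.integral_of_le hε.le]
  have havg : ⨍ s in Set.Ioc 0 ε, (τ s (f : A), τ s (D f)) ∈ (G : Set (A × A)) := by
    have hconv : Convex ℝ (G : Set (A × A)) := (G.restrictScalars ℝ).convex
    refine hconv.set_average_mem
      D.graph.isClosed_topologicalClosure (by simpa using hε) (by simp) ?_ ?_
    · exact (MeasureTheory.ae_restrict_iff' measurableSet_Ioc).2
        (Eventually.of_forall fun s hs => hinv f s (Set.Ioc_subset_Icc_self hs))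
    · exact (hc.integrableOn_Icc).mono_set Set.Ioc_subset_Icc_self
  rw [MeasureTheory.setAverage_eq] at havg
  have := (G.restrictScalars ℝ).smul_mem (MeasureTheory.volume.real (Set.Ioc 0 ε)) havg
  rwa [smul_inv_smul₀ (by simp [hε.le, hε.ne'])] at this

/-- An operator `D` with `(d/dt) τ_t f = τ_t (D f)` is closable, and its closure is the whole
generator as soon as, for small `t`, the element `τ_t f` is in the domain of the closure, with
image `τ_t (D f)`. To see this for `f` in the domain of the generator, approximate it by the
averages of its orbit over the intervals `[0, ε]`: the pair formed by this average and by
`(τ_ε f - f) / ε` is in the closure of the graph, because this is so on a dense set of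
elements `f`. -/
theorem isClosable_and_isGeneratorOf_closure {τ : ℝ → A ≃⋆ₐ[ℂ] A} (hτ : IsAutomorphismGroup τ)
    (hnorm : ∀ t f, ‖τ t f‖ = ‖f‖) (D : A →ₗ.[ℂ] A) (hD : Dense (D.domain : Set A))
    (hderiv : ∀ (f : D.domain) t, HasDerivAt (fun s : ℝ => τ s f) (τ t (D f)) t) {T : ℝ}
    (hT : 0 < T)
    (hinv : ∀ (f : D.domain), ∀ t ∈ Set.Icc 0 T, (τ t f, τ t (D f)) ∈ D.graph.topologicalClosure) :
    D.IsClosable ∧ IsGeneratorOf D.closure τ := by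
  have hgraph : ∀ p ∈ (D.graph : Set (A × A)), ∀ t,
      HasDerivAt (fun s : ℝ => τ s p.1) (τ t p.2) t := by
    intro p hp t
    obtain ⟨y, h1, h2⟩ := (LinearPMap.mem_graph_iff D).1 hp
    rw [← h1, ← h2]
    exact hderiv y t
  have hclosure : ∀ p ∈ D.graph.topologicalClosure, ∀ t,
      HasDerivAt (fun s : ℝ => τ s p.1) (τ t p.2) t := fun p hp t =>
    hasDerivAt_of_mem_closure hnorm hgraph hp t
  have hclosable : D.IsClosable := by
    refine LinearPMap.isClosable_of_forall_mem_closure D fun g hg => ?_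
    have h1 := hclosure _ hg 0
    simp only [map_zero, hτ.zero] at h1
    exact h1.unique (hasDerivAt_const _ _)
  refine ⟨hclosable, fun f g => ?_⟩
  rw [← hclosable.graph_closure_eq_closure_graph]
  refine ⟨fun h => by simpa only [hτ.zero] using hclosure _ h 0, fun h => ?_⟩
  have hmem : ∀ᶠ ε in 𝓝[>] (0 : ℝ), (ε⁻¹ • ∫ s in (0 : ℝ)..ε, τ s f, ε⁻¹ • (τ ε f - f)) ∈
      D.graph.topologicalClosure := by
    filter_upwards [Ioc_mem_nhdsGT hT] with ε hε
    refine (D.graph.topologicalClosure.restrictScalars ℝ).smul_mem ε⁻¹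
      (integral_orbit_mem_graph_closure_of_dense hτ hnorm D hD (fun y => ?_) f)
    exact integral_orbit_mem_graph_closure hτ D hderiv hε.1
      (fun y t ht => hinv y t ⟨ht.1, ht.2.trans hε.2⟩) y
  have hne : 𝓝[>] (0 : ℝ) ≤ 𝓝[≠] 0 := nhdsWithin_mono 0 fun x hx => ne_of_gt hx
  refine D.graph.isClosed_topologicalClosure.mem_of_tendsto (Tendsto.prodMk_nhds ?_ ?_) hmem
  · have h1 := ((hτ.continuous f).integral_hasStrictDerivAt 0 0).hasDerivAt
    rw [hasDerivAt_iff_tendsto_slope_zero] at h1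
    simpa [hτ.zero] using h1.mono_left hne
  · rw [hasDerivAt_iff_tendsto_slope_zero] at h
    simpa [hτ.zero] using h.mono_left hne

end Generator

/-! ### Inner derivations and the one-parameter groups they generate -/

section InnerFlow

variable {A : Type} [NormedRing A] [NormedAlgebra ℂ A]

/-- The commutator `f ↦ a f - f a` as a bounded operator. -/
noncomputable def commutatorCLM (a : A) : A →L[ℂ] A :=
  ContinuousLinearMap.mul ℂ A a - (ContinuousLinearMap.mul ℂ A).flip a

@[simp] theorem commutatorCLM_apply (a f : A) : commutatorCLM a f = a * f - f * a := by
  simp [commutatorCLM]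

theorem commutatorCLM_smul (c : ℂ) (a : A) : commutatorCLM (c • a) = c • commutatorCLM a := by
  ext f
  simp [smul_sub]

theorem commutatorCLM_sum {ι : Type*} (s : Finset ι) (a : ι → A) :
    commutatorCLM (∑ i ∈ s, a i) = ∑ i ∈ s, commutatorCLM (a i) := by
  ext f
  simp [Finset.sum_mul, Finset.mul_sum]

theorem enorm_commutatorCLM_le (a f : A) : ‖commutatorCLM a f‖ₑ ≤ 2 * ‖a‖ₑ * ‖f‖ₑ := by
  rw [← enorm_norm a, ← enorm_norm f, ← enorm_norm (commutatorCLM a f), two_mul, add_mul,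
    Real.enorm_of_nonneg (norm_nonneg _), Real.enorm_of_nonneg (norm_nonneg _),
    Real.enorm_of_nonneg (norm_nonneg _), ← ENNReal.ofReal_mul (norm_nonneg _),
    ← ENNReal.ofReal_add (by positivity) (by positivity)]
  refine ENNReal.ofReal_le_ofReal ?_
  rw [commutatorCLM_apply]
  refine (norm_sub_le _ _).trans (add_le_add (norm_mul_le _ _) ?_)
  rw [mul_comm]
  exact norm_mul_le _ _

theorem commute_exp_smul (c : ℂ) (a : A) : Commute a (NormedSpace.exp (c • a)) := by
  let +nondep : NormedAlgebra ℚ A := .restrictScalars ℚ ℂ _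
  exact ((Commute.refl a).smul_right c).exp_right

variable [CompleteSpace A]

theorem exp_commutatorCLM (a f : A) :
    NormedSpace.exp (commutatorCLM a) f = NormedSpace.exp a * f * NormedSpace.exp (-a) := by
  let +nondep : NormedAlgebra ℚ (A →L[ℂ] A) := .restrictScalars ℚ ℂ _
  have hl : NormedSpace.exp (ContinuousLinearMap.mul ℂ A a) =
      ContinuousLinearMap.mul ℂ A (NormedSpace.exp a) := by
    have h := (NormedSpace.exp_series_hasSum_exp' (𝕂 := ℂ) a).mapL (ContinuousLinearMap.mul ℂ A)
    have hpow : ∀ n : ℕ, ContinuousLinearMap.mul ℂ A (a ^ n) =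
        ContinuousLinearMap.mul ℂ A a ^ n := by
      intro n
      induction n with
      | zero => ext f; simp
      | succ n ih => rw [pow_succ, pow_succ, ← ih]; ext f; simp [mul_assoc]
    simp only [map_smul, hpow] at h
    exact (NormedSpace.exp_series_hasSum_exp' (𝕂 := ℂ) _).unique h
  have hr : NormedSpace.exp (-(ContinuousLinearMap.mul ℂ A).flip a) =
      (ContinuousLinearMap.mul ℂ A).flip (NormedSpace.exp (-a)) := by
    have h := (NormedSpace.exp_series_hasSum_exp' (𝕂 := ℂ) (-a)).mapL
      (ContinuousLinearMap.mul ℂ A).flip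
    have hpow : ∀ n : ℕ, (ContinuousLinearMap.mul ℂ A).flip ((-a) ^ n) =
        (-(ContinuousLinearMap.mul ℂ A).flip a) ^ n := by
      intro n
      induction n with
      | zero => ext f; simp
      | succ n ih => rw [pow_succ', pow_succ, ← ih]; ext f; simp [mul_assoc]
    simp only [map_smul, hpow] at h
    exact (NormedSpace.exp_series_hasSum_exp' (𝕂 := ℂ) _).unique h
  have hcomm : Commute (ContinuousLinearMap.mul ℂ A a) (-(ContinuousLinearMap.mul ℂ A).flip a) := by
    refine Commute.neg_right ?_
    ext f
    simp [mul_assoc]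
  rw [commutatorCLM, sub_eq_add_neg, NormedSpace.exp_add_of_commute hcomm, hl, hr]
  simp [mul_assoc]

theorem hasSum_exp_smul (c : ℂ) (a : A) :
    HasSum (fun n : ℕ => ((n.factorial : ℂ)⁻¹ * c ^ n) • a ^ n) (NormedSpace.exp (c • a)) := by
  simpa only [smul_pow, smul_smul] using NormedSpace.exp_series_hasSum_exp' (𝕂 := ℂ) (c • a)

variable [StarRing A] [StarModule ℂ A] [ContinuousStar A]

/-- The one-parameter group `t ↦ e^{itH} · e^{-itH}` of a self-adjoint element `H`. -/
noncomputable def innerFlow (H : selfAdjoint A) (t : ℝ) : A ≃⋆ₐ[ℂ] A :=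
  Unitary.conjStarAlgAut ℂ A (selfAdjoint.expUnitary (t • H))

theorem innerFlow_apply (H : selfAdjoint A) (t : ℝ) (f : A) :
    innerFlow H t f = NormedSpace.exp ((Complex.I * (t : ℂ)) • (H : A)) * f *
      NormedSpace.exp (-((Complex.I * (t : ℂ)) • (H : A))) := by
  have h : (Complex.I • ((t • H : selfAdjoint A) : A)) = (Complex.I * (t : ℂ)) • (H : A) := by
    rw [mul_smul, selfAdjoint.val_smul, Complex.coe_smul]
  rw [innerFlow, Unitary.conjStarAlgAut_apply, selfAdjoint.expUnitary_coe, h, NormedSpace.star_exp]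
  congr 2
  rw [star_smul, H.2.star_eq]
  simp

/-- The generator `f ↦ i (H f - f H)` of `innerFlow H`. -/
noncomputable def innerGenerator (H : A) : A →L[ℂ] A := Complex.I • commutatorCLM H

theorem innerFlow_eq_exp (H : selfAdjoint A) (t : ℝ) (f : A) :
    innerFlow H t f = NormedSpace.exp ((t : ℂ) • innerGenerator (H : A)) f := by
  rw [innerFlow_apply, ← exp_commutatorCLM, commutatorCLM_smul, innerGenerator, smul_smul, mul_comm]

theorem isAutomorphismGroup_innerFlow (H : selfAdjoint A) : IsAutomorphismGroup (innerFlow H) where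
  zero f := by simp [innerFlow]
  add s t f := by
    have hc : Commute ((s • H : selfAdjoint A) : A) ((t • H : selfAdjoint A) : A) := by
      simpa using ((Commute.refl (H : A)).smul_left s).smul_right t
    rw [innerFlow, add_smul, hc.expUnitary_add, map_mul]
    rfl
  continuous f := by
    let +nondep : NormedAlgebra ℚ A := .restrictScalars ℚ ℂ _
    simp only [innerFlow_apply]
    fun_prop

theorem norm_innerFlow [CStarRing A] (H : selfAdjoint A) (t : ℝ) (f : A) :
    ‖innerFlow H t f‖ = ‖f‖ := by
  rw [innerFlow, Unitary.conjStarAlgAut_apply, mul_assoc, CStarRing.norm_coe_unitary_mul,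
    ← Unitary.coe_star, CStarRing.norm_mul_coe_unitary]

theorem hasDerivAt_innerFlow (H : selfAdjoint A) (f : A) (t : ℝ) :
    HasDerivAt (fun s => innerFlow H s f) (innerFlow H t (innerGenerator (H : A) f)) t := by
  have h := ((ContinuousLinearMap.apply ℂ A f).hasFDerivAt.comp_hasDerivAt (t : ℂ)
    (hasDerivAt_exp_smul_const (𝕂 := ℂ) (innerGenerator (H : A)) (t : ℂ))).scomp t
      Complex.ofRealCLM.hasDerivAt
  have h2 : (fun s => innerFlow H s f) = ((ContinuousLinearMap.apply ℂ A f) ∘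
      fun z : ℂ => NormedSpace.exp (z • innerGenerator (H : A))) ∘ Complex.ofRealCLM := by
    funext s
    simp [innerFlow_eq_exp]
  rw [h2]
  refine h.congr_deriv ?_
  rw [innerFlow_eq_exp, Complex.ofRealCLM_apply, Complex.ofReal_one, one_smul]
  rfl

theorem innerGenerator_innerFlow (H : selfAdjoint A) (t : ℝ) (f : A) :
    innerGenerator (H : A) (innerFlow H t f) = innerFlow H t (innerGenerator (H : A) f) := by
  have h : Commute (innerGenerator (H : A)) (NormedSpace.exp ((t : ℂ) • innerGenerator (H : A))) :=
    commute_exp_smul _ _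
  rw [innerFlow_eq_exp, innerFlow_eq_exp, ← mul_apply_eq_comp, h.eq, mul_apply_eq_comp]

theorem hasSum_innerFlow (H : selfAdjoint A) (t : ℝ) (f : A) :
    HasSum (fun n : ℕ => ((n.factorial : ℂ)⁻¹ * (t : ℂ) ^ n) • (innerGenerator (H : A) ^ n) f)
      (innerFlow H t f) := by
  rw [innerFlow_eq_exp]
  have h := (hasSum_exp_smul (t : ℂ) (innerGenerator (H : A))).mapL
    (ContinuousLinearMap.apply ℂ A f)
  exact h

end InnerFlow

/-! ### Majorants for iterated commutators -/

section Majorant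

open scoped ENNReal

variable {L : Type*} [DecidableEq L]

/-- Let the weight `w X` bound the norm of the interaction term of `X`, and `m Y` the norm of the
part of an observable that is localized in `Y`. Then `majorantStep w m Z` bounds the norm of the
part of its commutator with the sum of all interaction terms that is localized in `Z`: the
commutator of the terms of `X` and `Y` vanishes if `X` and `Y` are disjoint, and is localized in
`X ∪ Y` otherwise. -/
noncomputable def majorantStep (w m : Finset L → ℝ≥0∞) (Z : Finset L) : ℝ≥0∞ :=
  ∑' p : Finset L × Finset L, if ¬Disjoint p.1 p.2 ∧ p.1 ∪ p.2 = Z then 2 * w p.1 * m p.2 else 0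

/-- The bound that a majorant `m` gives for the norm of the commutator of an observable with the
interaction term of `X`. -/
noncomputable def commutatorMajorant (w m : Finset L → ℝ≥0∞) (X : Finset L) : ℝ≥0∞ :=
  ∑' Y : Finset L, if ¬Disjoint X Y then 2 * w X * m Y else 0

/-- The total mass of a majorant, with weight exponential in the number of sites. -/
noncomputable def expMass (ν : ℝ) (m : Finset L → ℝ≥0∞) : ℝ≥0∞ :=
  ∑' Y : Finset L, ENNReal.ofReal (Real.exp (ν * Y.card)) * m Y

theorem tsum_mul_majorantStep (w m g : Finset L → ℝ≥0∞) :
    ∑' Z, g Z * majorantStep w m Z =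
      ∑' Y, ∑' X, if ¬Disjoint X Y then g (X ∪ Y) * (2 * w X * m Y) else 0 := by
  simp only [majorantStep, ← ENNReal.tsum_mul_left]
  rw [ENNReal.tsum_comm, ENNReal.tsum_prod', ENNReal.tsum_comm]
  refine tsum_congr fun Y => tsum_congr fun X => ?_
  by_cases h : Disjoint X Y
  · simp [h]
  · simp only [h, not_false_eq_true, true_and, if_true, mul_ite, mul_zero]
    rw [tsum_eq_single (X ∪ Y)]
    · simp
    · intro Z hZ
      simp [Ne.symm hZ]

theorem tsum_commutatorMajorant (w m : Finset L → ℝ≥0∞) :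
    ∑' X, commutatorMajorant w m X = expMass 0 (majorantStep w m) := by
  have h := tsum_mul_majorantStep w m 1
  simp only [Pi.one_apply, one_mul] at h
  simp only [expMass, zero_mul, Real.exp_zero, ENNReal.ofReal_one, one_mul, h, commutatorMajorant]
  exact ENNReal.tsum_comm

variable {w : Finset L → ℝ≥0∞} {lam C : ℝ}

theorem exp_card_union_le {ν : ℝ} (hν : 0 ≤ ν) (hνlam : ν ≤ lam) {X Y : Finset L} {x : L}
    (hX : x ∈ X) (hY : x ∈ Y) :
    Real.exp (ν * (X ∪ Y).card) ≤ Real.exp (ν * Y.card) * Real.exp (lam * (X.card - 1 : ℝ)) := by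
  rw [← Real.exp_add]
  refine Real.exp_le_exp.2 ?_
  have h1 : ((X ∪ Y).card : ℝ) + 1 ≤ X.card + Y.card := by
    have hpos : 0 < (X ∩ Y).card := Finset.card_pos.2 ⟨x, Finset.mem_inter.2 ⟨hX, hY⟩⟩
    have := Finset.card_union_add_card_inter X Y
    exact_mod_cast (by omega : (X ∪ Y).card + 1 ≤ X.card + Y.card)
  have h2 : (1 : ℝ) ≤ X.card := by exact_mod_cast Finset.card_pos.2 ⟨x, hX⟩
  nlinarith

/-- One commutator costs a factor proportional to the number of sites, which is absorbed by lowering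
the exponential weight from `ν + h` to `ν`. -/
theorem expMass_majorantStep_le
    (hw : ∀ x, ∑' X : Finset L, (if x ∈ X then
      ENNReal.ofReal (Real.exp (lam * (X.card - 1 : ℝ))) * w X else 0) ≤ ENNReal.ofReal C)
    (hC : 0 ≤ C) {ν h : ℝ} (hν : 0 ≤ ν) (hνlam : ν ≤ lam) (hh : 0 < h) (m : Finset L → ℝ≥0∞) :
    expMass ν (majorantStep w m) ≤ ENNReal.ofReal (2 * C / h) * expMass (ν + h) m := by
  rw [expMass, tsum_mul_majorantStep, expMass, ← ENNReal.tsum_mul_left]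
  refine ENNReal.tsum_le_tsum fun Y => ?_
  have h1 : ∀ X : Finset L,
      (if ¬Disjoint X Y then
        ENNReal.ofReal (Real.exp (ν * (X ∪ Y).card)) * (2 * w X * m Y) else 0) ≤
      ∑ x ∈ Y, (2 * ENNReal.ofReal (Real.exp (ν * Y.card)) * m Y) * (if x ∈ X then
      ENNReal.ofReal (Real.exp (lam * (X.card - 1 : ℝ))) * w X else 0) := by
    intro X
    by_cases hXY : Disjoint X Y
    · simp [hXY]
    · rw [if_pos hXY]
      obtain ⟨x, hxX, hxY⟩ := Finset.not_disjoint_iff.1 hXY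
      refine le_trans ?_ (Finset.single_le_sum (fun _ _ => zero_le) hxY)
      rw [if_pos hxX]
      calc _ ≤ ENNReal.ofReal (Real.exp (ν * Y.card) * Real.exp (lam * (X.card - 1 : ℝ))) *
            (2 * w X * m Y) := by
            gcongr
            exact exp_card_union_le hν hνlam hxX hxY
        _ = _ := by
            rw [ENNReal.ofReal_mul (Real.exp_pos _).le]
            ring
  refine (ENNReal.tsum_le_tsum h1).trans ?_
  rw [Summable.tsum_finsetSum fun _ _ => ENNReal.summable]
  simp only [ENNReal.tsum_mul_left]
  refine (Finset.sum_le_sum fun x _ => mul_le_mul_right (hw x) _).trans ?_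
  rw [Finset.sum_const, nsmul_eq_mul, ← ENNReal.ofReal_natCast]
  have h2 : (Y.card : ℝ) * (2 * Real.exp (ν * Y.card)) * C ≤
      2 * C / h * Real.exp ((ν + h) * Y.card) := by
    have h3 : h * Y.card ≤ Real.exp (h * Y.card) := by
      linarith [Real.add_one_le_exp (h * Y.card)]
    rw [add_mul, Real.exp_add, div_mul_eq_mul_div, le_div_iff₀ hh]
    have h4 := mul_le_mul_of_nonneg_left h3
      (show 0 ≤ 2 * C * Real.exp (ν * Y.card) by positivity)
    linarith
  calc _ = ENNReal.ofReal ((Y.card : ℝ) * (2 * Real.exp (ν * Y.card)) * C) * m Y := by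
        rw [ENNReal.ofReal_mul (by positivity), ENNReal.ofReal_mul (by positivity),
          ENNReal.ofReal_mul (by positivity), ENNReal.ofReal_ofNat]
        ring
    _ ≤ ENNReal.ofReal (2 * C / h * Real.exp ((ν + h) * Y.card)) * m Y := by gcongr
    _ = _ := by
        rw [ENNReal.ofReal_mul (by positivity), mul_assoc]

theorem expMass_iterate_majorantStep_le
    (hw : ∀ x, ∑' X : Finset L, (if x ∈ X then
      ENNReal.ofReal (Real.exp (lam * (X.card - 1 : ℝ))) * w X else 0) ≤ ENNReal.ofReal C)
    (hC : 0 ≤ C) {h : ℝ} (hh : 0 < h) (m : Finset L → ℝ≥0∞) (n : ℕ) :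
    ∀ ν : ℝ, 0 ≤ ν → ν + n * h ≤ lam →
      expMass ν ((majorantStep w)^[n] m) ≤
        ENNReal.ofReal ((2 * C / h) ^ n) * expMass (ν + n * h) m := by
  induction n with
  | zero => intro ν _ _; simp
  | succ n ih =>
    intro ν hν hle
    push_cast at hle ⊢
    have hn : 0 ≤ n * h := by positivity
    rw [Function.iterate_succ_apply']
    refine (expMass_majorantStep_le hw hC hν (by linarith) hh _).trans ?_
    refine (mul_le_mul_right (ih (ν + h) (by linarith) (by linarith)) _).trans_eq ?_
    rw [← mul_assoc, ← ENNReal.ofReal_mul (by positivity), ← pow_succ',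
      show ν + h + n * h = ν + (n + 1) * h by ring]

/-- The exponential series of the iterated commutators converges for small times: the `n`-fold
commutator, estimated in `n` steps each of which lowers the exponential weight by `lam / n`, grows
at most like `n ^ n`. -/
theorem exists_pos_tsum_expMass_lt_top
    (hw : ∀ x, ∑' X : Finset L, (if x ∈ X then
      ENNReal.ofReal (Real.exp (lam * (X.card - 1 : ℝ))) * w X else 0) ≤ ENNReal.ofReal C)
    (hC : 0 ≤ C) (hlam : 0 < lam) :
    ∃ T : ℝ, 0 < T ∧ ∀ m : Finset L → ℝ≥0∞, expMass lam m < ⊤ →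
      ∑' n : ℕ, ENNReal.ofReal (T ^ n / n.factorial) *
        expMass 0 ((majorantStep w)^[n + 1] m) < ⊤ := by
  have he : 0 < Real.exp 1 := Real.exp_pos 1
  -- with this `T`, the terms are dominated by those of `∑ (n + 1) r ^ n` with `r < 1 / 2`
  set T : ℝ := lam / (4 * Real.exp 1 * (C + 1)) with hT
  have hT0 : 0 < T := by positivity
  set r : ℝ := T * Real.exp 1 * (2 * C / lam) with hr
  have hr0 : 0 ≤ r := by positivity
  have hr1 : r < 1 := by
    have : r = C / (2 * (C + 1)) := by rw [hr, hT]; field_simp; ring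
    rw [this, div_lt_one (by positivity)]
    linarith
  refine ⟨T, hT0, fun m hm => ?_⟩
  -- the bounds `(n + 1) ^ (n + 1)` of the steps are absorbed by `(n + 1) ^ n / n! ≤ e ^ (n + 1)`
  have hterm : ∀ n : ℕ,
      ENNReal.ofReal (T ^ n / n.factorial) * expMass 0 ((majorantStep w)^[n + 1] m) ≤
      ENNReal.ofReal (2 * C / lam * Real.exp 1 * ((n + 1) * r ^ n)) * expMass lam m := by
    intro n
    have hn : (0 : ℝ) < n + 1 := by positivity
    have h1 := expMass_iterate_majorantStep_le hw hC (h := lam / (n + 1)) (by positivity) m (n + 1)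
      0 le_rfl (by push_cast; rw [mul_div_cancel₀ _ hn.ne', zero_add])
    rw [Nat.cast_add_one, mul_div_cancel₀ _ hn.ne', zero_add] at h1
    refine (mul_le_mul_right h1 _).trans ?_
    rw [← mul_assoc, ← ENNReal.ofReal_mul (by positivity)]
    refine mul_le_mul_left (ENNReal.ofReal_le_ofReal ?_) _
    have h2 : ((n : ℝ) + 1) ^ n / n.factorial ≤ Real.exp 1 ^ (n + 1) := by
      have := Real.pow_div_factorial_le_exp ((n : ℝ) + 1) hn.le n
      rwa [← Real.exp_nat_mul, mul_one, Nat.cast_add_one]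
    calc T ^ n / n.factorial * (2 * C / (lam / (n + 1))) ^ (n + 1)
        = T ^ n * (2 * C / lam) ^ (n + 1) * (n + 1) * (((n : ℝ) + 1) ^ n / n.factorial) := by
          rw [show 2 * C / (lam / ((n : ℝ) + 1)) = (2 * C / lam) * (n + 1) by field_simp, mul_pow,
            pow_succ ((n : ℝ) + 1)]
          ring
      _ ≤ T ^ n * (2 * C / lam) ^ (n + 1) * (n + 1) * Real.exp 1 ^ (n + 1) := by gcongr
      _ = _ := by rw [hr]; ring
  refine (ENNReal.tsum_le_tsum hterm).trans_lt ?_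
  rw [ENNReal.tsum_mul_right]
  refine ENNReal.mul_lt_top ?_ hm
  have hs : Summable fun n : ℕ => 2 * C / lam * Real.exp 1 * (((n : ℝ) + 1) * r ^ n) := by
    refine Summable.mul_left _ ?_
    have hr' : ‖r‖ < 1 := by rwa [Real.norm_of_nonneg hr0]
    simpa [add_mul] using (summable_pow_mul_geometric_of_norm_lt_one 1 hr').add
      (summable_geometric_of_norm_lt_one hr')
  exact hs.tsum_ofReal_lt_top

end Majorant

/-! ### Quasilocal algebras and interactions -/

section Quasilocal

open scoped ENNReal

/-- A quasilocal structure on a C*-algebra: an increasing family of closed `*`-subalgebras,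
indexed by the finite sets of sites, with dense union, such that the subalgebras of disjoint sets
commute. -/
structure QuasilocalNet (L A : Type*) [NormedRing A] [StarRing A] [NormedAlgebra ℂ A]
    [StarModule ℂ A] where
  /-- The subalgebra of observables localized in a finite set of sites. -/
  alg : Finset L → StarSubalgebra ℂ A
  mono : Monotone alg
  isClosed : ∀ X, IsClosed (alg X : Set A)
  commute : ∀ {X Y a b}, Disjoint X Y → a ∈ alg X → b ∈ alg Y → Commute a b
  dense : Dense {a | ∃ X, a ∈ alg X}

/-- An interaction on a quasilocal algebra whose terms decay exponentially with the number of sites: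
`∑_{X ∋ x} e^{lam (|X| - 1)} ‖φ_X‖ ≤ C` for all sites `x`, with `lam > 0`. -/
structure QuasilocalNet.DecayingInteraction {L A : Type*} [DecidableEq L] [NormedRing A]
    [StarRing A] [NormedAlgebra ℂ A] [StarModule ℂ A] (N : QuasilocalNet L A) (lam C : ℝ) where
  lam_pos : 0 < lam
  nonneg : 0 ≤ C
  /-- The interaction term of a finite set of sites. -/
  term : Finset L → A
  isSelfAdjoint : ∀ X, IsSelfAdjoint (term X)
  mem_alg : ∀ X, term X ∈ N.alg X
  tsum_le : ∀ x, ∑' X : Finset L, (if x ∈ X then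
    ENNReal.ofReal (Real.exp (lam * (X.card - 1 : ℝ))) * ‖term X‖ₑ else 0) ≤ ENNReal.ofReal C

namespace QuasilocalNet

variable {L : Type*} {A : Type} [NormedRing A] [StarRing A] [NormedAlgebra ℂ A]
  [StarModule ℂ A] (N : QuasilocalNet L A)

/-- The element `a` is a finite sum of local elements, in which the norm of the summand localized in
`Y` is at most `m Y`. -/
def IsDominated (m : Finset L → ℝ≥0∞) (a : A) : Prop :=
  ∃ u : Finset L →₀ A, (∀ Y, u Y ∈ N.alg Y) ∧ (∀ Y, ‖u Y‖ₑ ≤ m Y) ∧ a = ∑ Y ∈ u.support, u Y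

variable {N}

theorem isDominated_zero (m : Finset L → ℝ≥0∞) : N.IsDominated m 0 :=
  ⟨0, fun Y => by simp, fun Y => by simp, by simp⟩

theorem isDominated_single {Y : Finset L} {a : A} (ha : a ∈ N.alg Y) {m : Finset L → ℝ≥0∞}
    (hm : ‖a‖ₑ ≤ m Y) : N.IsDominated m a := by
  refine ⟨Finsupp.single Y a, fun Z => ?_, fun Z => ?_, ?_⟩
  · by_cases h : Y = Z
    · subst h; simpa using ha
    · simp [Finsupp.single_eq_of_ne (Ne.symm h)]
  · by_cases h : Y = Z
    · subst h; simpa using hm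
    · simp [Finsupp.single_eq_of_ne (Ne.symm h)]
  · exact (Finsupp.sum_single_index (h := fun _ b => b) rfl).symm

theorem IsDominated.mono {m m' : Finset L → ℝ≥0∞} {a : A} (h : N.IsDominated m a) (hm : m ≤ m') :
    N.IsDominated m' a :=
  let ⟨u, h1, h2, h3⟩ := h
  ⟨u, h1, fun Y => (h2 Y).trans (hm Y), h3⟩

theorem IsDominated.add {m m' : Finset L → ℝ≥0∞} {a a' : A} (h : N.IsDominated m a)
    (h' : N.IsDominated m' a') : N.IsDominated (m + m') (a + a') := by
  obtain ⟨u, h1, h2, rfl⟩ := h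
  obtain ⟨v, h1', h2', rfl⟩ := h'
  refine ⟨u + v, fun Y => add_mem (h1 Y) (h1' Y),
    fun Y => (enorm_add_le _ _).trans (add_le_add (h2 Y) (h2' Y)), ?_⟩
  exact (Finsupp.sum_add_index' (h := fun _ b => b) (fun _ => rfl) fun _ _ _ => rfl).symm

theorem isDominated_sum {ι : Type*} (s : Finset ι) {m : ι → Finset L → ℝ≥0∞} {a : ι → A}
    (h : ∀ i ∈ s, N.IsDominated (m i) (a i)) :
    N.IsDominated (∑ i ∈ s, m i) (∑ i ∈ s, a i) := by
  classical
  induction s using Finset.induction_on with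
  | empty => simpa using isDominated_zero 0
  | insert i s hi ih =>
    rw [Finset.sum_insert hi, Finset.sum_insert hi]
    exact (h i (Finset.mem_insert_self i s)).add (ih fun j hj => h j (Finset.mem_insert_of_mem hj))

namespace DecayingInteraction

variable [DecidableEq L] {lam C : ℝ} (φ : N.DecayingInteraction lam C)

/-- The norms of the interaction terms. -/
noncomputable def weight (X : Finset L) : ℝ≥0∞ := ‖φ.term X‖ₑ

theorem commutatorCLM_term_eq_zero {X Y : Finset L} (h : Disjoint X Y) {a : A} (ha : a ∈ N.alg Y) :
    commutatorCLM (φ.term X) a = 0 := by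
  rw [commutatorCLM_apply, (N.commute h (φ.mem_alg X) ha).eq, sub_self]

theorem commutatorCLM_mem_alg {X Y : Finset L} {a b : A} (ha : a ∈ N.alg X) (hb : b ∈ N.alg Y) :
    commutatorCLM a b ∈ N.alg (X ∪ Y) := by
  have ha' := N.mono (Finset.subset_union_left (s₂ := Y)) ha
  have hb' := N.mono (Finset.subset_union_right (s₁ := X)) hb
  rw [commutatorCLM_apply]
  exact sub_mem (mul_mem ha' hb') (mul_mem hb' ha')

theorem isDominated_innerGenerator {m : Finset L → ℝ≥0∞} {a : A} (ha : N.IsDominated m a)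
    (P : Finset (Finset L)) :
    N.IsDominated (majorantStep φ.weight m) (innerGenerator (∑ X ∈ P, φ.term X) a) := by
  obtain ⟨u, h1, h2, rfl⟩ := ha
  have hsum : innerGenerator (∑ X ∈ P, φ.term X) (∑ Y ∈ u.support, u Y) =
      ∑ p ∈ P ×ˢ u.support, Complex.I • commutatorCLM (φ.term p.1) (u p.2) := by
    rw [innerGenerator, commutatorCLM_sum, Finset.sum_product_right]
    simp [Finset.smul_sum, map_sum]
  rw [hsum]
  refine IsDominated.mono (isDominated_sum (P ×ˢ u.support)
    (m := fun p Z => if ¬Disjoint p.1 p.2 ∧ p.1 ∪ p.2 = Z then 2 * φ.weight p.1 * m p.2 else 0)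
    fun p _ => ?_) fun Z => ?_
  · by_cases h : Disjoint p.1 p.2
    · rw [φ.commutatorCLM_term_eq_zero h (h1 p.2), smul_zero]
      exact isDominated_zero _
    · refine isDominated_single (Y := p.1 ∪ p.2)
        (SMulMemClass.smul_mem _ (commutatorCLM_mem_alg (φ.mem_alg p.1) (h1 p.2))) ?_
      rw [if_pos ⟨h, rfl⟩, enorm_smul]
      have hI : ‖Complex.I‖ₑ = 1 := by simp [← ofReal_norm]
      rw [hI, one_mul]
      refine (enorm_commutatorCLM_le _ _).trans ?_
      have := h2 p.2
      unfold weight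
      gcongr
  · rw [Finset.sum_apply]
    exact ENNReal.sum_le_tsum _

theorem isDominated_innerGenerator_pow {m : Finset L → ℝ≥0∞} {a : A} (ha : N.IsDominated m a)
    (P : Finset (Finset L)) (n : ℕ) :
    N.IsDominated ((majorantStep φ.weight)^[n] m)
      ((innerGenerator (∑ X ∈ P, φ.term X) ^ n) a) := by
  induction n with
  | zero => simpa using ha
  | succ n ih =>
    rw [Function.iterate_succ_apply', pow_succ', mul_apply_eq_comp]
    exact φ.isDominated_innerGenerator ih P

theorem enorm_commutatorCLM_term_le {m : Finset L → ℝ≥0∞} {a : A} (ha : N.IsDominated m a)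
    (X : Finset L) : ‖commutatorCLM (φ.term X) a‖ₑ ≤ commutatorMajorant φ.weight m X := by
  obtain ⟨u, h1, h2, rfl⟩ := ha
  rw [map_sum]
  refine (enorm_sum_le _ _).trans ((Finset.sum_le_sum fun Y _ => ?_).trans
    (ENNReal.sum_le_tsum u.support))
  by_cases h : Disjoint X Y
  · rw [φ.commutatorCLM_term_eq_zero h (h1 Y)]
    simp
  · rw [if_pos h]
    refine (enorm_commutatorCLM_le _ _).trans ?_
    have := h2 Y
    unfold weight
    gcongr

/-- A bound, uniform in the finite volume and in the times in `[-T, T]`, for the norm of the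
commutator of the interaction term of `X` with the evolution of a dominated element. -/
noncomputable def evolvedMajorant (T : ℝ) (m : Finset L → ℝ≥0∞) (X : Finset L) : ℝ≥0∞ :=
  ∑' n : ℕ, ENNReal.ofReal (T ^ n / n.factorial) *
    commutatorMajorant φ.weight ((majorantStep φ.weight)^[n] m) X

theorem tsum_evolvedMajorant (T : ℝ) (m : Finset L → ℝ≥0∞) :
    ∑' X, φ.evolvedMajorant T m X = ∑' n : ℕ, ENNReal.ofReal (T ^ n / n.factorial) *
      expMass 0 ((majorantStep φ.weight)^[n + 1] m) := by
  simp only [evolvedMajorant]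
  rw [ENNReal.tsum_comm]
  refine tsum_congr fun n => ?_
  rw [ENNReal.tsum_mul_left, tsum_commutatorMajorant, Function.iterate_succ_apply']

variable [CStarRing A] [CompleteSpace A]

/-- The Hamiltonian of a finite set of sites. -/
noncomputable def hamiltonian (Λ : Finset L) : selfAdjoint A :=
  ⟨∑ X ∈ Λ.powerset, φ.term X, sum_mem fun X _ => φ.isSelfAdjoint X⟩

/-- The dynamics generated by the Hamiltonian of a finite set of sites. -/
noncomputable def localFlow (Λ : Finset L) : ℝ → A ≃⋆ₐ[ℂ] A := innerFlow (φ.hamiltonian Λ)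

/-- The evolution of a local element in a finite volume stays local: the partial sums of its power
series are local, and the local subalgebras are closed. -/
theorem localFlow_mem_alg {Λ Y : Finset L} {f : A} (hf : f ∈ N.alg Y) (t : ℝ) :
    φ.localFlow Λ t f ∈ N.alg (Λ ∪ Y) := by
  have hH : (φ.hamiltonian Λ : A) ∈ N.alg (Λ ∪ Y) := sum_mem fun X hX =>
    N.mono ((Finset.mem_powerset.1 hX).trans Finset.subset_union_left) (φ.mem_alg X)
  have hpow : ∀ n : ℕ, (innerGenerator (φ.hamiltonian Λ : A) ^ n) f ∈ N.alg (Λ ∪ Y) := by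
    intro n
    induction n with
    | zero => simpa using N.mono Finset.subset_union_right hf
    | succ n ih =>
      rw [pow_succ', mul_apply_eq_comp]
      have hmem := commutatorCLM_mem_alg hH ih
      rw [Finset.union_self] at hmem
      exact SMulMemClass.smul_mem _ hmem
  refine (N.isClosed (Λ ∪ Y)).mem_of_tendsto (hasSum_innerFlow (φ.hamiltonian Λ) t f)
    (Eventually.of_forall fun s => ?_)
  exact sum_mem fun n _ => SMulMemClass.smul_mem _ (hpow n)

theorem enorm_commutatorCLM_localFlow_le {m : Finset L → ℝ≥0∞} {f : A} (hf : N.IsDominated m f)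
    (Λ X : Finset L) {t T : ℝ} (ht : |t| ≤ T) :
    ‖commutatorCLM (φ.term X) (φ.localFlow Λ t f)‖ₑ ≤ φ.evolvedMajorant T m X := by
  have h := (hasSum_innerFlow (φ.hamiltonian Λ) t f).mapL (commutatorCLM (φ.term X))
  rw [localFlow, ← h.tsum_eq]
  refine enorm_tsum_le_tsum_enorm.trans (ENNReal.tsum_le_tsum fun n => ?_)
  rw [map_smul, enorm_smul]
  refine mul_le_mul' ?_ (φ.enorm_commutatorCLM_term_le
    (φ.isDominated_innerGenerator_pow hf Λ.powerset n) X)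
  rw [← ofReal_norm]
  refine ENNReal.ofReal_le_ofReal ?_
  rw [norm_mul, norm_inv, norm_pow, Complex.norm_natCast, Complex.norm_real, Real.norm_eq_abs,
    inv_mul_eq_div]
  gcongr

end DecayingInteraction

end QuasilocalNet

end Quasilocal

/-! ### Comparison of inner dynamics -/

section InnerFlow

variable {A : Type} [NormedRing A] [StarRing A] [NormedAlgebra ℂ A]
  [StarModule ℂ A] [CStarRing A] [CompleteSpace A]

theorem hasDerivAt_innerFlow_neg_innerFlow (H K : selfAdjoint A) (f : A) (t : ℝ) :
    HasDerivAt (fun s => innerFlow K (-s) (innerFlow H s f))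
      (innerFlow K (-t) (innerGenerator (H : A) (innerFlow H t f) -
        innerGenerator (K : A) (innerFlow H t f))) t := by
  have hneg : ∀ c : ℂ, c • -innerGenerator (K : A) = -c • innerGenerator (K : A) := fun c => by
    ext g
    simp
  have hH := (ContinuousLinearMap.apply ℂ A f).hasFDerivAt.comp_hasDerivAt (t : ℂ)
    (hasDerivAt_exp_smul_const' (𝕂 := ℂ) (innerGenerator (H : A)) (t : ℂ))
  have hK := hasDerivAt_exp_smul_const (𝕂 := ℂ) (-innerGenerator (K : A)) (t : ℂ)
  have h := (hK.clm_apply hH).scomp t Complex.ofRealCLM.hasDerivAt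
  have h2 : (fun s => innerFlow K (-s) (innerFlow H s f)) =
      (fun z : ℂ => NormedSpace.exp (z • -innerGenerator (K : A))
        (((ContinuousLinearMap.apply ℂ A f) ∘
          fun z : ℂ => NormedSpace.exp (z • innerGenerator (H : A))) z)) ∘ Complex.ofRealCLM := by
    funext s
    rw [innerFlow_eq_exp, innerFlow_eq_exp, Complex.ofReal_neg, ← hneg]
    rfl
  rw [h2]
  refine h.congr_deriv ?_
  rw [Complex.ofRealCLM_apply, Complex.ofReal_one, one_smul, innerFlow_eq_exp, Complex.ofReal_neg,
    ← hneg]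
  simp only [Function.comp_apply, ContinuousLinearMap.apply_apply, mul_apply_eq_comp, map_sub,
    innerFlow_eq_exp, neg_apply, map_neg]
  rw [neg_add_eq_sub]

/-- Two inner dynamics are compared by interpolating between them, along
`s ↦ e^{-isK} e^{isH} f e^{-isH} e^{isK}`. -/
theorem norm_innerFlow_sub_innerFlow_le (H K : selfAdjoint A) (f : A) {t C : ℝ}
    (hC : ∀ s, |s| ≤ |t| → ‖innerGenerator (H : A) (innerFlow H s f) -
        innerGenerator (K : A) (innerFlow H s f)‖ ≤ C) :
    ‖innerFlow H t f - innerFlow K t f‖ ≤ C * |t| := by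
  have h := (convex_Icc (-|t|) |t|).norm_image_sub_le_of_norm_hasDerivWithin_le
    (f := fun s => innerFlow K (-s) (innerFlow H s f)) (x := 0) (y := t) (C := C)
    (fun s _ => (hasDerivAt_innerFlow_neg_innerFlow H K f s).hasDerivWithinAt)
    (fun s hs => by rw [norm_innerFlow]; exact hC s (abs_le.2 hs))
    ⟨by simp, by simp⟩ ⟨neg_abs_le t, le_abs_self t⟩
  have hK := isAutomorphismGroup_innerFlow K
  rw [neg_zero, hK.zero, (isAutomorphismGroup_innerFlow H).zero, sub_zero, Real.norm_eq_abs] at h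
  rw [← norm_innerFlow K (-t), map_sub, ← hK.add, neg_add_cancel, hK.zero]
  exact h

end InnerFlow

/-! ### The infinite-volume derivation and dynamics -/

section Quasilocal

open scoped ENNReal

theorem expMass_piSingle_lt_top {L : Type*} [DecidableEq L] (ν : ℝ) (Y : Finset L) {c : ℝ≥0∞}
    (hc : c < ⊤) :
    expMass ν (Pi.single Y c) < ⊤ := by
  rw [expMass, tsum_eq_single Y fun Z hZ => by simp [hZ]]
  simpa using ENNReal.mul_lt_top ENNReal.ofReal_lt_top hc

theorem enorm_I_smul {A : Type*} [NormedRing A] [NormedAlgebra ℂ A] (f : A) :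
    ‖Complex.I • f‖ₑ = ‖f‖ₑ := by
  rw [enorm_smul, show ‖Complex.I‖ₑ = 1 by simp [← ofReal_norm], one_mul]

namespace QuasilocalNet

variable {L : Type*} {A : Type} [NormedRing A] [StarRing A] [NormedAlgebra ℂ A]
  [StarModule ℂ A] {N : QuasilocalNet L A}

theorem isDominated_piSingle [DecidableEq L] {Y : Finset L} {f : A} (hf : f ∈ N.alg Y) :
    N.IsDominated (Pi.single Y ‖f‖ₑ) f :=
  isDominated_single hf (by simp)

variable (N) in
/-- The space of all local elements. -/
noncomputable def localSubmodule : Submodule ℂ A :=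
  ⨆ X, Subalgebra.toSubmodule (N.alg X).toSubalgebra

theorem mem_localSubmodule [DecidableEq L] {f : A} : f ∈ N.localSubmodule ↔ ∃ X, f ∈ N.alg X :=
  Submodule.mem_iSup_of_directed _ (Monotone.directed_le fun _ _ h => N.mono h)

namespace DecayingInteraction

variable [DecidableEq L] {lam C : ℝ} (φ : N.DecayingInteraction lam C)

theorem tsum_enorm_commutatorCLM_lt_top {f : A} (hf : f ∈ N.localSubmodule) :
    ∑' X, ‖commutatorCLM (φ.term X) f‖ₑ < ⊤ := by
  obtain ⟨Y, hY⟩ := mem_localSubmodule.1 hf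
  refine (ENNReal.tsum_le_tsum
    (φ.enorm_commutatorCLM_term_le (isDominated_piSingle hY))).trans_lt ?_
  rw [tsum_commutatorMajorant]
  refine (expMass_majorantStep_le φ.tsum_le φ.nonneg le_rfl φ.lam_pos.le φ.lam_pos _).trans_lt ?_
  exact ENNReal.mul_lt_top ENNReal.ofReal_lt_top (expMass_piSingle_lt_top _ Y enorm_lt_top)

theorem summable_norm_commutatorCLM {f : A} (hf : f ∈ N.localSubmodule) :
    Summable fun X => ‖commutatorCLM (φ.term X) f‖ :=
  tsum_enorm_ne_top_iff_summable_norm.1 (φ.tsum_enorm_commutatorCLM_lt_top hf).ne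

variable [CompleteSpace A]

theorem summable_commutatorCLM {f : A} (hf : f ∈ N.localSubmodule) :
    Summable fun X => commutatorCLM (φ.term X) f :=
  (φ.summable_norm_commutatorCLM hf).of_norm

/-- The derivation `f ↦ i ∑_X [φ_X, f]` on the local elements. -/
noncomputable def derivation : A →ₗ.[ℂ] A where
  domain := N.localSubmodule
  toFun :=
    { toFun := fun f => Complex.I • ∑' X, commutatorCLM (φ.term X) f
      map_add' := fun f g => by
        simp only [Submodule.coe_add, map_add]
        rw [(φ.summable_commutatorCLM f.2).tsum_add (φ.summable_commutatorCLM g.2), smul_add]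
      map_smul' := fun c f => by
        simp only [SetLike.val_smul, map_smul, RingHom.id_apply]
        rw [(φ.summable_commutatorCLM f.2).tsum_const_smul, smul_comm] }

theorem derivation_apply (f : φ.derivation.domain) :
    φ.derivation f = Complex.I • ∑' X, commutatorCLM (φ.term X) f := rfl

theorem dense_domain_derivation : Dense (φ.derivation.domain : Set A) := by
  refine N.dense.mono fun f hf => ?_
  exact mem_localSubmodule.2 hf

/-- An upper bound, uniform in times in `[-T, T]`, for the effect of the interaction terms that are
not contained in `Λ`. -/
noncomputable def tailMajorant (T : ℝ) (m : Finset L → ℝ≥0∞) (Λ : Finset L) : ℝ≥0∞ :=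
  ∑' X : {X // X ∉ Λ.powerset}, φ.evolvedMajorant T m X

omit [CompleteSpace A] in
theorem tendsto_tailMajorant {T : ℝ} {m : Finset L → ℝ≥0∞} (h : ∑' X, φ.evolvedMajorant T m X ≠ ⊤) :
    Tendsto (φ.tailMajorant T m) atTop (𝓝 0) :=
  (ENNReal.tendsto_tsum_compl_atTop_zero h).comp tendsto_finset_powerset_atTop_atTop

variable [CStarRing A]

theorem norm_localFlow (Λ : Finset L) (t : ℝ) (f : A) : ‖φ.localFlow Λ t f‖ = ‖f‖ :=
  norm_innerFlow _ t f

theorem innerGenerator_localFlow (Λ : Finset L) (t : ℝ) (f : A) :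
    innerGenerator (φ.hamiltonian Λ : A) (φ.localFlow Λ t f) =
      φ.localFlow Λ t (innerGenerator (φ.hamiltonian Λ : A) f) :=
  innerGenerator_innerFlow _ t f

theorem isStarDerivation_derivation : IsStarDerivation φ.derivation := by
  refine ⟨fun f g => ?_, fun f => ?_⟩
  · obtain ⟨X, hX⟩ := mem_localSubmodule.1 f.2
    obtain ⟨Y, hY⟩ := mem_localSubmodule.1 g.2
    have hmem : (f : A) * (g : A) ∈ φ.derivation.domain := mem_localSubmodule.2 ⟨X ∪ Y,
      mul_mem (N.mono Finset.subset_union_left hX) (N.mono Finset.subset_union_right hY)⟩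
    refine ⟨hmem, ?_⟩
    have hf := φ.summable_commutatorCLM f.2
    have hg := φ.summable_commutatorCLM g.2
    simp only [derivation_apply]
    rw [smul_mul_assoc, mul_smul_comm, ← smul_add, ← hf.tsum_mul_right, ← hg.tsum_mul_left,
      ← (hf.mul_right _).tsum_add (hg.mul_left _)]
    congr 1
    refine tsum_congr fun Z => ?_
    simp only [commutatorCLM_apply]
    noncomm_ring
  · obtain ⟨X, hX⟩ := mem_localSubmodule.1 f.2
    have hmem : star (f : A) ∈ φ.derivation.domain := mem_localSubmodule.2 ⟨X, star_mem hX⟩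
    refine ⟨hmem, ?_⟩
    simp only [derivation_apply]
    rw [star_smul, tsum_star, Complex.star_def, Complex.conj_I, neg_smul, ← smul_neg, ← tsum_neg]
    congr 1
    refine tsum_congr fun Z => ?_
    simp [(φ.isSelfAdjoint Z).star_eq]

omit [CompleteSpace A] [CStarRing A] in
theorem innerGenerator_hamiltonian_apply (Λ : Finset L) (f : A) :
    innerGenerator (φ.hamiltonian Λ : A) f =
      Complex.I • ∑ X ∈ Λ.powerset, commutatorCLM (φ.term X) f := by
  simp [innerGenerator, hamiltonian, commutatorCLM_sum]

omit [CStarRing A] in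
theorem tendsto_innerGenerator_hamiltonian (f : φ.derivation.domain) :
    Tendsto (fun Λ => innerGenerator (φ.hamiltonian Λ : A) (f : A)) atTop (𝓝 (φ.derivation f)) := by
  simp only [innerGenerator_hamiltonian_apply]
  exact Tendsto.const_smul
    ((φ.summable_commutatorCLM f.2).hasSum.comp tendsto_finset_powerset_atTop_atTop) _

theorem enorm_innerGenerator_sub_le {m : Finset L → ℝ≥0∞} {f : A} (hf : N.IsDominated m f)
    {Λ Λ' : Finset L} (hΛ : Λ ⊆ Λ') {t T : ℝ} (ht : |t| ≤ T) :
    ‖innerGenerator (φ.hamiltonian Λ : A) (φ.localFlow Λ t f) -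
      innerGenerator (φ.hamiltonian Λ' : A) (φ.localFlow Λ t f)‖ₑ ≤ φ.tailMajorant T m Λ := by
  rw [enorm_sub_rev, innerGenerator_hamiltonian_apply, innerGenerator_hamiltonian_apply, ← smul_sub,
    enorm_I_smul, ← Finset.sum_sdiff_eq_sub (Finset.powerset_mono.2 hΛ)]
  refine (enorm_sum_le _ _).trans ((Finset.sum_le_sum fun X _ =>
    φ.enorm_commutatorCLM_localFlow_le hf Λ X ht).trans ?_)
  rw [← Finset.sum_subtype_of_mem (p := fun X => X ∉ Λ.powerset) _
    fun X hX => (Finset.mem_sdiff.1 hX).2]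
  exact ENNReal.sum_le_tsum _

theorem enorm_derivation_sub_le {m : Finset L → ℝ≥0∞} {f : A} (hf : N.IsDominated m f)
    {Λ : Finset L} {t T : ℝ} (ht : |t| ≤ T) (hmem : φ.localFlow Λ t f ∈ φ.derivation.domain) :
    ‖φ.derivation ⟨φ.localFlow Λ t f, hmem⟩ -
      innerGenerator (φ.hamiltonian Λ : A) (φ.localFlow Λ t f)‖ₑ ≤ φ.tailMajorant T m Λ := by
  rw [innerGenerator_hamiltonian_apply, derivation_apply, ← smul_sub, enorm_I_smul,
    ← (φ.summable_commutatorCLM hmem).sum_add_tsum_compl (s := Λ.powerset), add_sub_cancel_left]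
  exact enorm_tsum_le_tsum_enorm.trans
    (ENNReal.tsum_le_tsum fun X => φ.enorm_commutatorCLM_localFlow_le hf Λ X ht)

omit [CompleteSpace A] [CStarRing A] in
theorem tailMajorant_ne_top {T : ℝ} {m : Finset L → ℝ≥0∞} (h : ∑' X, φ.evolvedMajorant T m X ≠ ⊤)
    (Λ : Finset L) : φ.tailMajorant T m Λ ≠ ⊤ :=
  ((ENNReal.tsum_comp_le_tsum_of_injective Subtype.val_injective _).trans_lt
    (lt_top_iff_ne_top.2 h)).ne

/-- Every finite-volume dynamics on a large volume is compared with that of a fixed smaller one. -/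
theorem uniformCauchySeqOn_localFlow {m : Finset L → ℝ≥0∞} {f : A} (hf : N.IsDominated m f) {T : ℝ}
    (hT : 0 < T) (h : ∑' X, φ.evolvedMajorant T m X ≠ ⊤) :
    UniformCauchySeqOn (fun Λ t => φ.localFlow Λ t f) atTop (Set.Icc (-T) T) := by
  rw [uniformCauchySeqOn_iff_eventually_dist_lt]
  intro ε hε
  have hlim := (ENNReal.tendsto_toReal ENNReal.zero_ne_top).comp (φ.tendsto_tailMajorant h)
  obtain ⟨Λ₀, hΛ₀⟩ := (hlim.eventually_lt_const
    (show (0 : ENNReal).toReal < ε / (2 * T) by rw [ENNReal.toReal_zero]; positivity)).exists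
  have key : ∀ Λ, Λ₀ ≤ Λ → ∀ t ∈ Set.Icc (-T) T,
      dist (φ.localFlow Λ₀ t f) (φ.localFlow Λ t f) < ε / 2 := by
    intro Λ hΛ t ht
    have ht' : |t| ≤ T := abs_le.2 ht
    rw [dist_eq_norm]
    refine (norm_innerFlow_sub_innerFlow_le (C := (φ.tailMajorant T m Λ₀).toReal) _ _ f
      fun s hs => ?_).trans_lt ?_
    · rw [← toReal_enorm]
      exact ENNReal.toReal_mono (φ.tailMajorant_ne_top h Λ₀)
        (φ.enorm_innerGenerator_sub_le hf hΛ (hs.trans ht'))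
    · calc (φ.tailMajorant T m Λ₀).toReal * |t| ≤ (φ.tailMajorant T m Λ₀).toReal * T := by gcongr
        _ < ε / (2 * T) * T := by
          have := hΛ₀
          simp only [Function.comp_apply] at this
          gcongr
        _ = ε / 2 := by field_simp
  filter_upwards [(eventually_ge_atTop Λ₀).prod_mk (eventually_ge_atTop Λ₀)] with p hp t ht
  have h1 := key p.1 hp.1 t ht
  have h2 := key p.2 hp.2 t ht
  have h3 := dist_triangle_left (φ.localFlow p.1 t f) (φ.localFlow p.2 t f) (φ.localFlow Λ₀ t f)
  exact h3.trans_lt (by linarith)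

omit [CompleteSpace A] [CStarRing A] in
/-- The time `T` is such that the exponential series of the iterated commutators of local elements
converge up to time `T`. -/
theorem exists_pos_tsum_evolvedMajorant_ne_top : ∃ T : ℝ, 0 < T ∧ ∀ f ∈ N.localSubmodule,
    ∃ m, N.IsDominated m f ∧ ∑' X, φ.evolvedMajorant T m X ≠ ⊤ := by
  obtain ⟨T, hT, h⟩ := exists_pos_tsum_expMass_lt_top φ.tsum_le φ.nonneg φ.lam_pos
  refine ⟨T, hT, fun f hf => ?_⟩
  obtain ⟨Y, hY⟩ := mem_localSubmodule.1 hf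
  refine ⟨_, isDominated_piSingle hY, ?_⟩
  rw [tsum_evolvedMajorant]
  exact (h _ (expMass_piSingle_lt_top _ Y enorm_lt_top)).ne

theorem hasDerivAt_of_tendstoUniformlyOn_localFlow {τ : ℝ → A ≃⋆ₐ[ℂ] A}
    (hτ : ∀ f K, IsCompact K →
      TendstoUniformlyOn (fun Λ t => φ.localFlow Λ t f) (fun t => τ t f) atTop K)
    (f : φ.derivation.domain) (t : ℝ) :
    HasDerivAt (fun s : ℝ => τ s f) (τ t (φ.derivation f)) t := by
  refine hasDerivAt_of_tendstoLocallyUniformlyOn (l := atTop) (s := Set.univ)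
    (f := fun Λ s => φ.localFlow Λ s f)
    (f' := fun Λ s => φ.localFlow Λ s (innerGenerator (φ.hamiltonian Λ : A) f))
    (g' := fun s => τ s (φ.derivation f)) isOpen_univ ?_
    (Eventually.of_forall fun Λ s _ => hasDerivAt_innerFlow _ _ s) (fun s _ => ?_) (Set.mem_univ t)
  · rw [tendstoLocallyUniformlyOn_iff_forall_isCompact isOpen_univ]
    intro K _ hK
    rw [Metric.tendstoUniformlyOn_iff]
    intro ε hε
    have h1 := Metric.tendsto_nhds.1 (φ.tendsto_innerGenerator_hamiltonian f) (ε / 2) (half_pos hε)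
    have h2 := Metric.tendstoUniformlyOn_iff.1 (hτ (φ.derivation f) K hK) (ε / 2) (half_pos hε)
    filter_upwards [h1, h2] with Λ h1 h2 s hs
    refine (dist_triangle _ (φ.localFlow Λ s (φ.derivation f)) _).trans_lt ?_
    rw [dist_map_eq_of_norm_map (φ.norm_localFlow Λ s), dist_comm (φ.derivation f)]
    linarith [h2 s hs]
  · exact (hτ f {s} isCompact_singleton).tendsto_at (Set.mem_singleton s)

/-- Up to the effect of the interaction terms that are not contained in `Λ`, the derivation maps
`τ_t^Λ f` to `i [H_Λ, τ_t^Λ f] = τ_t^Λ (i [H_Λ, f])`. -/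
theorem mem_closure_graph_derivation {τ : ℝ → A ≃⋆ₐ[ℂ] A}
    (hτ : ∀ f t, Tendsto (fun Λ => φ.localFlow Λ t f) atTop (𝓝 (τ t f)))
    {m : Finset L → ℝ≥0∞} (f : φ.derivation.domain) (hf : N.IsDominated m (f : A)) {T : ℝ}
    (h : ∑' X, φ.evolvedMajorant T m X ≠ ⊤) {t : ℝ} (ht : |t| ≤ T) :
    (τ t f, τ t (φ.derivation f)) ∈ φ.derivation.graph.topologicalClosure := by
  obtain ⟨Y, hY⟩ := mem_localSubmodule.1 f.2
  have hmem : ∀ Λ, φ.localFlow Λ t f ∈ φ.derivation.domain := fun Λ =>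
    mem_localSubmodule.2 ⟨_, φ.localFlow_mem_alg hY t⟩
  refine mem_closure_of_tendsto (b := atTop) (Tendsto.prodMk_nhds (hτ f t) ?_)
    (Eventually.of_forall fun Λ => φ.derivation.mem_graph ⟨_, hmem Λ⟩)
  have h1 : Tendsto (fun Λ => φ.localFlow Λ t (innerGenerator (φ.hamiltonian Λ : A) (f : A))) atTop
      (𝓝 (τ t (φ.derivation f))) :=
    tendsto_map_of_tendsto φ.norm_localFlow
      (φ.tendsto_innerGenerator_hamiltonian f) (hτ _ t)
  have h2 : Tendsto (fun Λ => φ.derivation ⟨φ.localFlow Λ t f, hmem Λ⟩ -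
      innerGenerator (φ.hamiltonian Λ : A) (φ.localFlow Λ t f)) atTop (𝓝 0) := by
    rw [tendsto_zero_iff_enorm_tendsto_zero]
    exact tendsto_of_tendsto_of_tendsto_of_le_of_le tendsto_const_nhds (φ.tendsto_tailMajorant h)
      (fun _ => zero_le) fun Λ => φ.enorm_derivation_sub_le hf ht (hmem Λ)
  have h3 := h2.add h1
  rw [zero_add] at h3
  refine h3.congr fun Λ => ?_
  rw [← φ.innerGenerator_localFlow, sub_add_cancel]

/-- The dynamics of a decaying interaction exists, and is generated by the closure of
`φ.derivation`. -/
theorem exists_dynamics : φ.derivation.IsClosable ∧ ∃ τ : ℝ → A ≃⋆ₐ[ℂ] A,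
    IsAutomorphismGroup τ ∧ IsGeneratorOf φ.derivation.closure τ ∧ ∀ f K, IsCompact K →
      TendstoUniformlyOn (fun Λ t => φ.localFlow Λ t f) (fun t => τ t f) atTop K := by
  obtain ⟨T, hT, h⟩ := φ.exists_pos_tsum_evolvedMajorant_ne_top
  obtain ⟨τ, hτ, hnorm, hlim⟩ := exists_limit_automorphismGroup (l := atTop) (σ := φ.localFlow)
    (fun Λ => isAutomorphismGroup_innerFlow _) φ.norm_localFlow
    φ.dense_domain_derivation hT fun f hf => by
      obtain ⟨m, hm, hsum⟩ := h f hf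
      exact φ.uniformCauchySeqOn_localFlow hm hT hsum
  have := isClosable_and_isGeneratorOf_closure hτ hnorm φ.derivation φ.dense_domain_derivation
    (φ.hasDerivAt_of_tendstoUniformlyOn_localFlow hlim) hT fun f t ht => by
      obtain ⟨m, hm, hsum⟩ := h f f.2
      exact φ.mem_closure_graph_derivation
        (fun f t => (hlim f {t} isCompact_singleton).tendsto_at (Set.mem_singleton t)) f hm hsum
        (by rw [abs_of_nonneg ht.1]; exact ht.2)
  exact ⟨this.1, τ, hτ, this.2, hlim⟩

end DecayingInteraction

end QuasilocalNet

end Quasilocal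

/-! ### Local functions on the groupoid -/

section LocalFunctions

variable {S : Type} {q : ℕ}

/-- The function `F` on the groupoid comes from the groupoid of `Λ`: it depends only on the
configuration in `Λ`, and vanishes at the group elements that are not trivial off `Λ`. -/
def IsLocalFun (Λ : Finset S) (F : C_c(Arrow S q, ℂ)) : Prop :=
  (∀ σ ω g, (∀ x ∈ Λ, σ x = ω x) → F (σ, g) = F (ω, g)) ∧
  ∀ σ g x, x ∉ Λ → SpinGroup.val g x ≠ 1 → F (σ, g) = 0

theorem IsLocalFun.mono {Λ Λ' : Finset S} (h : Λ ⊆ Λ') {F : C_c(Arrow S q, ℂ)}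
    (hF : IsLocalFun Λ F) : IsLocalFun Λ' F :=
  ⟨fun σ ω g hσ => hF.1 σ ω g fun x hx => hσ x (h hx),
    fun σ g x hx => hF.2 σ g x fun hx' => hx (h hx')⟩

theorem SpinGroup.act_apply (g : SpinGroup S q) (σ : Config S q) (x : S) :
    g.act σ x = g.val x * σ x := rfl

theorem SpinGroup.val_injective : Function.Injective (SpinGroup.val : SpinGroup S q → Config S q) :=
  Subtype.val_injective

instance [NeZero q] [Finite S] : Finite (SpinGroup S q) :=
  Finite.of_injective _ SpinGroup.val_injective

open Classical in
/-- The extension of a configuration by `1`. -/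
noncomputable def extendConfig {Λ : Finset S} (σ : Config Λ q) : Config S q :=
  fun x => if h : x ∈ Λ then σ ⟨x, h⟩ else 1

/-- The extension of a group element by `1`. -/
noncomputable def extendSpin {Λ : Finset S} (g : SpinGroup Λ q) : SpinGroup S q :=
  ⟨extendConfig g.val, Λ.finite_toSet.subset fun x hx => by
    by_contra h
    exact hx (dif_neg h)⟩

variable [NeZero q]

theorem extendLocal_apply_of_forall {Λ : Finset S} (f : C_c(Arrow Λ q, ℂ)) (σ : Config S q)
    {g : SpinGroup S q} (hg : ∀ x, x ∉ Λ → g.val x = 1) :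
    extendLocal Λ f (σ, g) = f (fun x => σ x, g.restrict Λ) :=
  if_pos hg

theorem isLocalFun_extendLocal {Λ : Finset S} (f : C_c(Arrow Λ q, ℂ)) :
    IsLocalFun Λ (extendLocal Λ f) := by
  refine ⟨fun σ ω g h => ?_, fun σ g x hx hg => if_neg fun hcon => hg (hcon x hx)⟩
  by_cases hg : ∀ x, x ∉ Λ → g.val x = 1
  · rw [extendLocal_apply_of_forall f σ hg, extendLocal_apply_of_forall f ω hg,
      show (fun x : Λ => σ x) = fun x : Λ => ω x from funext fun x => h x x.2]
  · exact (if_neg hg).trans (if_neg hg).symm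

theorem IsLocalFun.exists_eq_extendLocal {Λ : Finset S} {F : C_c(Arrow S q, ℂ)}
    (hF : IsLocalFun Λ F) : ∃ f : C_c(Arrow Λ q, ℂ), F = extendLocal Λ f := by
  refine ⟨mkCc (fun p => F (extendConfig p.1, extendSpin p.2))
    (fun g => continuous_of_discreteTopology) (Set.toFinite _), ?_⟩
  ext ⟨σ, g⟩
  by_cases hg : ∀ x, x ∉ Λ → g.val x = 1
  · rw [extendLocal_apply_of_forall _ σ hg, mkCc_apply]
    have h : extendSpin (g.restrict Λ) = g := by
      apply SpinGroup.val_injective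
      funext x
      by_cases hx : x ∈ Λ
      · exact dif_pos hx
      · exact (dif_neg hx).trans (hg x hx).symm
    rw [h]
    exact hF.1 _ _ _ fun x hx => by simp [extendConfig, hx]
  · refine Eq.trans ?_ (if_neg hg).symm
    push Not at hg
    obtain ⟨x, hx, hgx⟩ := hg
    exact hF.2 σ g x hx hgx

omit [NeZero q] in
theorem IsLocalFun.add {Λ : Finset S} {F G : C_c(Arrow S q, ℂ)} (hF : IsLocalFun Λ F)
    (hG : IsLocalFun Λ G) : IsLocalFun Λ (F + G) :=
  ⟨fun σ ω g h => by simp [hF.1 σ ω g h, hG.1 σ ω g h],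
    fun σ g x hx hg => by simp [hF.2 σ g x hx hg, hG.2 σ g x hx hg]⟩

theorem isLocalFun_scalarUnit (Λ : Finset S) (c : ℂ) :
    IsLocalFun Λ (scalarUnit c : C_c(Arrow S q, ℂ)) := by
  refine ⟨fun σ ω g _ => rfl, fun σ g x _ hg => if_neg ?_⟩
  rintro rfl
  exact hg (by simp)

theorem IsLocalFun.convolution {Λ : Finset S} {F G : C_c(Arrow S q, ℂ)} (hF : IsLocalFun Λ F)
    (hG : IsLocalFun Λ G) : IsLocalFun Λ (convolution F G) := by
  refine ⟨fun σ ω g h => finsum_congr fun k => ?_, fun σ g x hx hg => ?_⟩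
  · rw [hG.1 σ ω k h, hF.1 (k.act σ) (k.act ω) _ fun x hx => by
      rw [SpinGroup.act_apply, SpinGroup.act_apply, h x hx]]
  · refine (finsum_congr fun k => ?_).trans finsum_zero
    by_cases hk : k.val x = 1
    · rw [hF.2 _ (g * k⁻¹) x hx (by simpa [hk] using hg), zero_mul]
    · rw [hG.2 σ k x hx hk, mul_zero]

theorem IsLocalFun.involution {Λ : Finset S} {F : C_c(Arrow S q, ℂ)} (hF : IsLocalFun Λ F) :
    IsLocalFun Λ (involution F) := by
  refine ⟨fun σ ω g h => congrArg star (hF.1 _ _ _ fun x hx => ?_), fun σ g x hx hg => ?_⟩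
  · exact congrArg (g.val x * ·) (h x hx)
  · refine (congrArg star (hF.2 (g.act σ) g⁻¹ x hx (by simpa using hg))).trans (star_zero _)

/-- Functions that come from disjoint sets of sites commute: the shifts of the configuration on
one of the sets do not affect a function that depends on the configuration in the other. -/
theorem IsLocalFun.convolution_comm {X Y : Finset S} (hXY : Disjoint X Y) {F G : C_c(Arrow S q, ℂ)}
    (hF : IsLocalFun X F) (hG : IsLocalFun Y G) :
    _root_.convolution F G = _root_.convolution G F := by
  have key : ∀ {X Y : Finset S} {F G : C_c(Arrow S q, ℂ)}, Disjoint X Y → IsLocalFun X F →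
      IsLocalFun Y G → ∀ σ g k,
      F (k.act σ, g * k⁻¹) * G (σ, k) = F (σ, g * k⁻¹) * G (σ, k) := by
    intro X Y F G hXY hF hG σ g k
    by_cases hk : ∃ x ∉ Y, k.val x ≠ 1
    · obtain ⟨x, hx, hkx⟩ := hk
      rw [hG.2 σ k x hx hkx, mul_zero, mul_zero]
    · push Not at hk
      rw [hF.1 (k.act σ) σ _ fun x hx => by
        rw [SpinGroup.act_apply, hk x (Finset.disjoint_left.1 hXY hx), one_mul]]
  ext ⟨σ, g⟩
  change ∑ᶠ k : SpinGroup S q, F (k.act σ, g * k⁻¹) * G (σ, k) =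
    ∑ᶠ k : SpinGroup S q, G (k.act σ, g * k⁻¹) * F (σ, k)
  simp only [key hXY hF hG, key hXY.symm hG hF]
  rw [← finsum_comp_equiv (Equiv.divLeft g)]
  refine finsum_congr fun k => ?_
  simp [div_eq_mul_inv, mul_comm]

omit [NeZero q] in
theorem regRep_smul (c : ℂ) (f : C_c(Arrow S q, ℂ)) : regRep (c • f) = c • regRep f := by
  ext ξ p
  rw [regRep_apply]
  change _ = c * regRep f ξ p
  rw [regRep_apply, mul_finsum]
  exact finsum_congr fun h => mul_assoc _ _ _

/-! ### Approximation by local functions -/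

/-- A continuous function on the configurations is, up to `ε`, determined by finitely many sites. -/
theorem exists_finset_forall_dist_lt {f : Config S q → ℂ} (hf : Continuous f) {ε : ℝ} (hε : 0 < ε) :
    ∃ Λ : Finset S, ∀ σ ω, (∀ x ∈ Λ, σ x = ω x) → dist (f σ) (f ω) < ε := by
  classical
  have h : ∀ σ, ∃ Λ : Finset S, ∀ ω, (∀ x ∈ Λ, σ x = ω x) → dist (f ω) (f σ) < ε / 2 := by
    intro σ
    obtain ⟨I, u, hu, hsub⟩ := isOpen_pi_iff.1 (Metric.isOpen_ball.preimage hf) σ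
      (Metric.mem_ball_self (x := f σ) (half_pos hε))
    exact ⟨I, fun ω hω => hsub fun x hx => hω x hx ▸ (hu x hx).2⟩
  choose Λ hΛ using h
  obtain ⟨t, -, ht⟩ := isCompact_univ.elim_nhds_subcover
    (fun σ : Config S q => {ω | ∀ x ∈ Λ σ, σ x = ω x}) fun σ _ => by
      have : {ω : Config S q | ∀ x ∈ Λ σ, σ x = ω x} = (Λ σ : Set S).pi fun x => {σ x} := by
        ext ω
        simp [Set.mem_pi, eq_comm]
      rw [this]
      exact (isOpen_set_pi (Λ σ).finite_toSet fun _ _ => isOpen_discrete _).mem_nhds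
        fun x _ => rfl
  refine ⟨t.biUnion Λ, fun σ ω hσω => ?_⟩
  obtain ⟨ρ, hρ, hσ⟩ := Set.mem_iUnion₂.1 (ht (Set.mem_univ σ))
  have h1 := hΛ ρ σ hσ
  have h2 := hΛ ρ ω fun x hx => (hσ x hx).trans (hσω x (Finset.mem_biUnion.2 ⟨ρ, hρ, hx⟩))
  have h3 := dist_triangle_right (f σ) (f ω) (f ρ)
  linarith

theorem norm_weightedShift_le {I : Type} (w : I → ℂ) {C : ℝ} (hC : 0 ≤ C) (hw : ∀ i, ‖w i‖ ≤ C)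
    (e : I ≃ I) (T : lp (fun _ : I => ℂ) 2 →L[ℂ] lp (fun _ : I => ℂ) 2)
    (hT : ∀ ξ i, T ξ i = w i * ξ (e i)) : ‖T‖ ≤ C := by
  have hp : 0 < (2 : ENNReal).toReal := by simp
  refine T.opNorm_le_bound hC fun ξ => lp.norm_le_of_tsum_le hp (by positivity) ?_
  rw [Real.mul_rpow hC (norm_nonneg _), lp.norm_rpow_eq_tsum hp,
    ← e.tsum_eq (fun i => ‖ξ i‖ ^ (2 : ENNReal).toReal), ← tsum_mul_left]
  refine Summable.tsum_le_tsum (fun i => ?_) ((lp.memℓp (T ξ)).summable hp)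
    (((e.summable_iff (f := fun i => ‖ξ i‖ ^ (2 : ENNReal).toReal)).2
      ((lp.memℓp ξ).summable hp)).mul_left _)
  rw [hT, norm_mul, Real.mul_rpow (norm_nonneg _) (norm_nonneg _)]
  have := hw i
  gcongr

omit [NeZero q] in
theorem norm_regRep_le (f : C_c(Arrow S q, ℂ)) {P : Finset (SpinGroup S q)}
    (hP : groupSupport f ⊆ P) {ε : ℝ} (hε : 0 ≤ ε) (hf : ∀ p, ‖f p‖ ≤ ε) :
    ‖regRep f‖ ≤ P.card * ε := by
  choose T hT using exists_shift f
  have h : regRep f = ∑ k ∈ (finite_groupSupport f).toFinset, T k := by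
    ext ξ p
    rw [sum_shift_apply f T hT, regRep_apply]
  rw [h]
  refine (norm_sum_le_of_le _ fun k _ =>
    norm_weightedShift_le _ hε (fun p => hf _) _ (T k) (hT k)).trans ?_
  rw [Finset.sum_const, nsmul_eq_mul]
  gcongr
  exact fun k hk => hP ((Set.Finite.mem_toFinset _).1 hk)

/-- The approximation evaluates `f` at the configuration reset to `1` off a large finite set. -/
theorem exists_isLocalFun_norm_sub_lt (f : C_c(Arrow S q, ℂ)) {ε : ℝ} (hε : 0 < ε) :
    ∃ Λ F, IsLocalFun Λ F ∧ ‖regRep f - regRep F‖ < ε := by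
  classical
  set P := (finite_groupSupport f).toFinset with hP
  have hδ : 0 < ε / (P.card + 1) := by positivity
  choose Λ hΛ using fun g : SpinGroup S q => exists_finset_forall_dist_lt (continuous_slice f g) hδ
  let I : SpinGroup S q → Finset S := fun g => g.2.toFinset
  have hI : ∀ g x, SpinGroup.val g x ≠ 1 → x ∈ I g := fun g x hx => (Set.Finite.mem_toFinset _).2 hx
  let M : Finset S := P.biUnion fun g => Λ g ∪ I g
  have hΛM : ∀ g ∈ P, Λ g ⊆ M := fun g hg =>
    Finset.subset_union_left.trans (Finset.subset_biUnion_of_mem (fun g => Λ g ∪ I g) hg)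
  have hIM : ∀ g ∈ P, I g ⊆ M := fun g hg =>
    Finset.subset_union_right.trans (Finset.subset_biUnion_of_mem (fun g => Λ g ∪ I g) hg)
  let cut : Config S q → Config S q := fun σ => extendConfig fun x : M => σ x
  have hcut : ∀ σ x, x ∈ M → cut σ x = σ x := fun σ x hx => dif_pos hx
  have hcut' : Continuous cut := by
    refine continuous_pi fun x => ?_
    by_cases hx : x ∈ M
    · exact (continuous_apply x).congr fun σ => (hcut σ x hx).symm
    · exact (continuous_const (y := 1)).congr fun σ => (dif_neg hx : cut σ x = 1).symm
  let F : C_c(Arrow S q, ℂ) := mkCc (fun p => f (cut p.1, p.2))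
    (fun g => (continuous_slice f g).comp hcut')
    ((finite_groupSupport f).subset fun g ⟨σ, hσ⟩ => ⟨_, hσ⟩)
  have hzero : ∀ g ∉ P, ∀ σ, f (σ, g) = 0 := fun g hg σ =>
    eq_zero_of_notMem_groupSupport f (fun h => hg ((Set.Finite.mem_toFinset _).2 h)) σ
  refine ⟨M, F, ⟨fun σ ω g h => ?_, fun σ g x hx hg => ?_⟩, ?_⟩
  · have : cut σ = cut ω := by
      have h' : (fun x : M => σ x) = fun x : M => ω x := funext fun x => h x x.2
      simp only [cut, h']
    simp only [F, mkCc_apply, this]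
  · exact hzero g (fun hgP => hx (hIM g hgP (hI g x hg))) _
  · have hsub : regRep f - regRep F = regRep (f - F) := by
      rw [sub_eq_iff_eq_add, ← regRep_add, sub_add_cancel]
    rw [hsub]
    refine (norm_regRep_le (f - F) (P := P) ?_ hδ.le ?_).trans_lt ?_
    · rintro g ⟨σ, hσ⟩
      by_contra hg
      exact hσ (by simp [F, hzero g hg])
    · rintro ⟨σ, g⟩
      by_cases hg : g ∈ P
      · rw [CompactlySupportedContinuousMap.sub_apply, ← dist_eq_norm]
        exact (hΛ g σ (cut σ) fun x hx => (hcut σ x (hΛM g hg hx)).symm).le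
      · simpa [F, hzero g hg] using hδ.le
    · rw [mul_div_assoc', div_lt_iff₀ (by positivity)]
      nlinarith

end LocalFunctions

/-! ### The quasilocal structure of the groupoid C*-algebra -/

section Observables

variable {d q : ℕ} [NeZero q]

instance : CompleteSpace (Observables d q) :=
  (StarSubalgebra.isClosed_topologicalClosure (regImage (Fin d → ℤ) q)).completeSpace_coe

theorem mem_localOperators_iff {Λ : Finset (Fin d → ℤ)} {a : Observables d q} :
    a ∈ localOperators d q Λ ↔ ∃ F, IsLocalFun Λ F ∧
      (a : RegSpace (Fin d → ℤ) q →L[ℂ] RegSpace (Fin d → ℤ) q) = regRep F := by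
  constructor
  · rintro ⟨f, hf⟩
    exact ⟨_, isLocalFun_extendLocal f, hf⟩
  · rintro ⟨F, hF, ha⟩
    obtain ⟨f, rfl⟩ := hF.exists_eq_extendLocal
    exact ⟨f, ha⟩

/-- The local operators of a finite set of sites form a `*`-subalgebra. -/
def localSubalgebra (d q : ℕ) [NeZero q] (Λ : Finset (Fin d → ℤ)) :
    StarSubalgebra ℂ (Observables d q) where
  carrier := localOperators d q Λ
  mul_mem' := by
    intro a b ha hb
    obtain ⟨F, hF, ha⟩ := mem_localOperators_iff.1 ha
    obtain ⟨G, hG, hb⟩ := mem_localOperators_iff.1 hb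
    refine mem_localOperators_iff.2 ⟨_, hF.convolution hG, ?_⟩
    rw [regRep_convolution, ← ha, ← hb]
    rfl
  add_mem' := by
    intro a b ha hb
    obtain ⟨F, hF, ha⟩ := mem_localOperators_iff.1 ha
    obtain ⟨G, hG, hb⟩ := mem_localOperators_iff.1 hb
    refine mem_localOperators_iff.2 ⟨_, hF.add hG, ?_⟩
    rw [regRep_add, ← ha, ← hb]
    rfl
  algebraMap_mem' := fun c =>
    mem_localOperators_iff.2 ⟨_, isLocalFun_scalarUnit Λ c, (regRep_scalarUnit c).symm⟩
  star_mem' := by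
    intro a ha
    obtain ⟨F, hF, ha⟩ := mem_localOperators_iff.1 ha
    refine mem_localOperators_iff.2 ⟨_, hF.involution, ?_⟩
    rw [regRep_involution, ← ha]
    rfl

/-- All functions on the finite groupoid of `Λ`, represented as operators. -/
noncomputable def localRep (d q : ℕ) [NeZero q] (Λ : Finset (Fin d → ℤ)) :
    (Arrow Λ q → ℂ) →ₗ[ℂ] RegSpace (Fin d → ℤ) q →L[ℂ] RegSpace (Fin d → ℤ) q where
  toFun f := regRep (extendLocal Λ
    (mkCc f (fun _ => continuous_of_discreteTopology) (Set.toFinite _)))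
  map_add' f g := by
    rw [← regRep_add]
    congr 1
    ext p
    simp only [extendLocal, mkCc_apply, CompactlySupportedContinuousMap.add_apply, Pi.add_apply]
    split_ifs <;> simp
  map_smul' c f := by
    rw [← regRep_smul]
    congr 1
    ext p
    simp only [extendLocal, mkCc_apply, CompactlySupportedContinuousMap.smul_apply, Pi.smul_apply]
    split_ifs <;> simp

/-- The local operators of a finite set form a finite-dimensional space. -/
theorem isClosed_localSubalgebra (Λ : Finset (Fin d → ℤ)) :
    IsClosed (localSubalgebra d q Λ : Set (Observables d q)) := by
  have h : (localSubalgebra d q Λ : Set (Observables d q)) =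
      Subtype.val ⁻¹' (LinearMap.range (localRep d q Λ) :
        Set (RegSpace (Fin d → ℤ) q →L[ℂ] RegSpace (Fin d → ℤ) q)) := by
    ext a
    constructor
    · rintro ⟨f, hf⟩
      exact ⟨f, hf.symm⟩
    · rintro ⟨f, hf⟩
      exact ⟨_, hf.symm⟩
  rw [h]
  exact (Submodule.closed_of_finiteDimensional _).preimage continuous_subtype_val

theorem dense_localOperators : Dense {a : Observables d q | ∃ Λ, a ∈ localOperators d q Λ} := by
  rw [Metric.dense_iff]
  intro a ε hε
  obtain ⟨b, ⟨f, rfl⟩, hb⟩ := Metric.mem_closure_iff.1 a.2 (ε / 2) (half_pos hε)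
  obtain ⟨Λ, F, hF, hfF⟩ := exists_isLocalFun_norm_sub_lt f (half_pos hε)
  have hmem : regRep F ∈ reducedCStar (Fin d → ℤ) q := subset_closure ⟨F, rfl⟩
  refine ⟨⟨regRep F, hmem⟩, ?_, Λ, mem_localOperators_iff.2 ⟨F, hF, rfl⟩⟩
  rw [Metric.mem_ball, dist_comm]
  rw [← dist_eq_norm] at hfF
  refine (dist_triangle (a : RegSpace (Fin d → ℤ) q →L[ℂ] RegSpace (Fin d → ℤ) q) (regRep f)
    (regRep F)).trans_lt ?_
  linarith

/-- The quasilocal structure of the groupoid C*-algebra of the lattice. -/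
def latticeNet (d q : ℕ) [NeZero q] : QuasilocalNet (Fin d → ℤ) (Observables d q) where
  alg := localSubalgebra d q
  mono X Y h a ha := by
    obtain ⟨F, hF, ha⟩ := mem_localOperators_iff.1 ha
    exact mem_localOperators_iff.2 ⟨F, hF.mono h, ha⟩
  isClosed := isClosed_localSubalgebra
  commute := by
    intro X Y a b h ha hb
    obtain ⟨F, hF, ha⟩ := mem_localOperators_iff.1 ha
    obtain ⟨G, hG, hb⟩ := mem_localOperators_iff.1 hb
    apply Subtype.ext
    change (a : RegSpace (Fin d → ℤ) q →L[ℂ] RegSpace (Fin d → ℤ) q) * b = b * a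
    rw [ha, hb, ← regRep_convolution, ← regRep_convolution, hF.convolution_comm h hG]
  dense := dense_localOperators

namespace Interaction

/-- In `expNorm`, the supremum over the sites is taken separately for each number of sites, so it
bounds the sum over all `X` containing one given site. -/
theorem tsum_exp_card_mul_enorm_le (φ : Interaction d q) (lam : ℝ) (x : Fin d → ℤ) :
    ∑' X : Finset (Fin d → ℤ), (if x ∈ X then
      ENNReal.ofReal (Real.exp (lam * (X.card - 1 : ℝ))) * ‖φ X‖ₑ else 0) ≤ φ.expNorm lam := by
  calc _ ≤ ∑' (X : Finset (Fin d → ℤ)) (n : ℕ), ENNReal.ofReal (Real.exp (lam * n)) *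
        Set.indicator {X : Finset (Fin d → ℤ) | x ∈ X ∧ X.card = n + 1} (fun X => ‖φ X‖ₑ) X := by
        refine ENNReal.tsum_le_tsum fun X => ?_
        split_ifs with hX
        · have hcard : X.card = X.card - 1 + 1 :=
            (Nat.sub_add_cancel (Finset.card_pos.2 ⟨x, hX⟩)).symm
          refine le_trans (le_of_eq ?_) (ENNReal.le_tsum (X.card - 1))
          have hmem : X ∈ {Y : Finset (Fin d → ℤ) | x ∈ Y ∧ Y.card = X.card - 1 + 1} := ⟨hX, hcard⟩
          rw [Set.indicator_of_mem hmem, Nat.cast_pred (Finset.card_pos.2 ⟨x, hX⟩)]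
        · exact zero_le
    _ = ∑' n : ℕ, ENNReal.ofReal (Real.exp (lam * n)) *
        ∑' X : {X : Finset (Fin d → ℤ) // x ∈ X ∧ X.card = n + 1}, ‖φ X‖ₑ := by
        rw [ENNReal.tsum_comm]
        refine tsum_congr fun n => ?_
        rw [ENNReal.tsum_mul_left]
        congr 1
        exact (tsum_subtype {X : Finset (Fin d → ℤ) | x ∈ X ∧ X.card = n + 1}
          fun X => ‖φ X‖ₑ).symm
    _ ≤ _ := by
        refine ENNReal.tsum_le_tsum fun n => ?_
        gcongr
        exact le_iSup (fun x : Fin d → ℤ =>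
          ∑' X : {X : Finset (Fin d → ℤ) // x ∈ X ∧ X.card = n + 1}, ‖φ X‖ₑ) x

/-- An interaction with finite norm, as a decaying interaction on the quasilocal algebra. -/
def toDecayingInteraction (φ : Interaction d q) {lam : ℝ} (hlam : 0 < lam)
    (hφ : φ.expNorm lam < ⊤) : (latticeNet d q).DecayingInteraction lam (φ.expNorm lam).toReal where
  lam_pos := hlam
  nonneg := ENNReal.toReal_nonneg
  term := φ
  isSelfAdjoint := φ.selfAdjoint
  mem_alg := φ.isLocal
  tsum_le x := by
    rw [ENNReal.ofReal_toReal hφ.ne]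
    exact φ.tsum_exp_card_mul_enorm_le lam x

variable (φ : Interaction d q) {lam : ℝ} (hlam : 0 < lam) (hφ : φ.expNorm lam < ⊤)

theorem localFlow_toDecayingInteraction (Λ : Finset (Fin d → ℤ)) (t : ℝ) (f : Observables d q) :
    (φ.toDecayingInteraction hlam hφ).localFlow Λ t f = φ.localDynamics Λ t f :=
  innerFlow_apply _ t f

theorem isDerivationOf_derivation :
    φ.IsDerivationOf (φ.toDecayingInteraction hlam hφ).derivation := by
  refine ⟨fun f => QuasilocalNet.mem_localSubmodule, fun Λ f hf => ⟨?_, ?_⟩⟩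
  · have h := ((φ.toDecayingInteraction hlam hφ).summable_norm_commutatorCLM f.2).subtype
      {X | ∃ x ∈ X, x ∈ Λ}
    simp only [commutatorCLM_apply] at h
    exact h
  · rw [QuasilocalNet.DecayingInteraction.derivation_apply]
    congr 1
    rw [← tsum_subtype_eq_of_support_subset (s := {X | ∃ x ∈ X, x ∈ Λ})]
    · simp only [commutatorCLM_apply]
      rfl
    · intro X hX
      by_contra hcon
      refine hX ((φ.toDecayingInteraction hlam hφ).commutatorCLM_term_eq_zero (Y := Λ) ?_ hf)
      exact Finset.disjoint_left.2 fun x hx hx' => hcon ⟨x, hx, hx'⟩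

end Interaction

end Observables

theorem mainTheorem3 (d q : ℕ) [NeZero q] (φ : Interaction d q) (lam : ℝ) (hlam : 0 < lam)
    (hφ : φ.expNorm lam < ⊤) :
    ∃ D : Observables d q →ₗ.[ℂ] Observables d q,
      φ.IsDerivationOf D ∧ IsStarDerivation D ∧
      Dense (D.domain : Set (Observables d q)) ∧ D.IsClosable ∧
      ∃ τ : ℝ → Observables d q ≃⋆ₐ[ℂ] Observables d q,
        IsAutomorphismGroup τ ∧ IsGeneratorOf D.closure τ ∧
        ∀ (f : Observables d q) (K : Set ℝ), IsCompact K →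
          TendstoUniformlyOn (fun Λ t => φ.localDynamics Λ t f) (fun t => τ t f)
            Filter.atTop K := by
  set ψ := φ.toDecayingInteraction hlam hφ with hψ
  obtain ⟨hclosable, τ, hτ, hgen, hlim⟩ := ψ.exists_dynamics
  refine ⟨ψ.derivation, φ.isDerivationOf_derivation hlam hφ, ψ.isStarDerivation_derivation,
    ψ.dense_domain_derivation, hclosable, τ, hτ, hgen, fun f K hK => ?_⟩
  simp only [← φ.localFlow_toDecayingInteraction hlam hφ]
  exact hlim f K hK
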